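/- **Theorem (Noisy Feedback).** Let $P_1,P_2\ge 0$, $N>0$, and let $K_W$ be a real positive semidefinite $2\times 2$ matrix. Logarithms are natural. *Channel and capacity region.* At time $t$ the channel with inputs $x_{1,t},x_{2,t}\in\mathbb R$ has output $Y_t=x_{1,t}+x_{2,t}+Z_t$, and Transmitter $\nu\in\{1,2\}$ receives the feedback output $V_{\nu,t}=Y_t+W_{\nu,t}$. Here $\{Z_t\}$ is IID centred Gaussian of variance $N$, $\{(W_{1,t},W_{2,t})\}$ is IID centred bivariate Gaussian with covariance matrix $K_W$, and the messages $M_1,M_2$ (independent, uniform on finite nonempty sets $\mathcal M_1,\mathcal M_2$), $\{Z_t\}$ and $\{(W_{1,t},W_{2,t})\}$ are independent. A blocklength-$n$ powers-$(P_1,P_2)$ feedback code consists of (measurable) encoders $X_{\nu,t}=\varphi_{\nu,t}(M_\nu,V_{\nu,1},\dots,V_{\nu,t-1})$, $1\le t\le n$, with $\frac1n\sum_{t=1}^n \mathbb E[X_{\nu,t}^2]\le P_\nu$ for $\nu=1,2$, and a (measurable) decoder $\phi:\mathbb R^n\to\mathcal M_1\times\mathcal M_2$; its rates are $\frac1n\log|\mathcal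 M_1|$ and $\frac1n\log|\mathcal M_2|$. A pair $(R_1,R_2)$ with $R_1,R_2\ge 0$ is achievable if for every $\delta>0$ there are, for all sufficiently large $n$, blocklength-$n$ powers-$(P_1,P_2)$ feedback codes of rates exceeding $R_1-\delta$ and $R_2-\delta$ whose error probabilities $\Pr[\phi(Y_1,\dots,Y_n)\ne(M_1,M_2)]$ tend to $0$ as $n\to\infty$. The capacity region $\mathcal C_{\mathrm{NoisyFB}}(P_1,P_2,N,K_W)$ is the set of achievable pairs. *The region $\mathcal R$.* For a positive integer $\eta$, vectors $a_1,a_2\in\mathbb R^\eta$ and strictly lower-triangular $\eta\times\eta$ matrices $B_1,B_2$, put $$A=\begin{pmatrix}a_1&a_2\end{pmatrix},\quad A_d=\begin{pmatrix}a_1&0\\0&a_2\end{pmatrix},\quad B=\begin{pmatrix}B_1&B_2\end{pmatrix},\quad B_t=\begin{pmatrix}B_1\\B_2\end{pmatrix},\quad B_d=\begin{pmatrix}B_1&0\\0&B_2\end{pmatrix},\quad \bar B=\begin{pmatrix}B_1&B_1\\B_2&B_2\end{pmatrix},$$ $\Sigma=N I_\eta+B(K_W\otimes I_\eta)B^{\mathsf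 T}$ and $$Q=(I_{2\eta}-\bar B)^{-1}\bigl(A_dA_d^{\mathsf T}+N B_tB_t^{\mathsf T}+B_d(K_W\otimes I_\eta)B_d^{\mathsf T}\bigr)(I_{2\eta}-\bar B)^{-\mathsf T}.$$ For a matrix $C$ with $\eta$ columns and $CC^{\mathsf T}$ nonsingular, let $\mathcal L(C)$ be the set of pairs $R_1,R_2\ge0$ with $$R_1\le\tfrac1{2\eta}\log\tfrac{|C(a_1a_1^{\mathsf T}+\Sigma)C^{\mathsf T}|}{|C\Sigma C^{\mathsf T}|},\qquad R_2\le\tfrac1{2\eta}\log\tfrac{|C(a_2a_2^{\mathsf T}+\Sigma)C^{\mathsf T}|}{|C\Sigma C^{\mathsf T}|},\qquad R_1+R_2\le\tfrac1{2\eta}\log\tfrac{|C(AA^{\mathsf T}+\Sigma)C^{\mathsf T}|}{|C\Sigma C^{\mathsf T}|}.$$ For a $2\times\eta$ matrix $C$, the region $\mathcal R_{N,K_W}(\eta,a_1,a_2,B_1,B_2,C)$ is $\mathcal L(C)$ if $CC^{\mathsf T}$ is nonsingular; it is $\mathcal L(c)$ for a nonzero row $c$ of $C$ (any one; the choice does not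 matter) if $CC^{\mathsf T}$ is singular and $C\ne0$; and it is $\{(0,0)\}$ if $C=0$. Let $\mathcal R(P_1,P_2,N,K_W)$ be the closure of the union of $\mathcal R_{N,K_W}(\eta,a_1,a_2,B_1,B_2,C)$ over all $\eta\ge1$, $a_1,a_2\in\mathbb R^\eta$, strictly lower-triangular $B_1,B_2\in\mathbb R^{\eta\times\eta}$ and $C\in\mathbb R^{2\times\eta}$ that satisfy the trace constraints $$\operatorname{tr}\Bigl(\begin{pmatrix}I_\eta&0\end{pmatrix}Q\begin{pmatrix}I_\eta\\0\end{pmatrix}\Bigr)\le\eta P_1,\qquad \operatorname{tr}\Bigl(\begin{pmatrix}0&I_\eta\end{pmatrix}Q\begin{pmatrix}0\\I_\eta\end{pmatrix}\Bigr)\le\eta P_2 .$$ *Claim.* $\mathcal C_{\mathrm{NoisyFB}}(P_1,P_2,N,K_W)\supseteq\mathcal R(P_1,P_2,N,K_W)$. -/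

import Mathlib

open MeasureTheory ProbabilityTheory Filter Topology
open scoped Kronecker

/-! # The two-user AWGN multiple-access channel with noisy feedback

The two transmitters are indexed by `ν : Fin 2`, times `1, …, n` by `t : Fin n` (starting at `0`),
and all logarithms are natural. -/

namespace NoisyFBMAC

noncomputable section

/-! ## Channel, feedback codes and capacity region -/

/-- Law of the noise `(Z_t, (W_{1,t}, W_{2,t}))` at one time: `Z_t` is centred Gaussian of variance
`N`, the pair `(W_{1,t}, W_{2,t})` is centred Gaussian of covariance matrix `KW`, and the two are
independent. -/
def noiseLaw (N : ℝ) (KW : Matrix (Fin 2) (Fin 2) ℝ) :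
    Measure (ℝ × EuclideanSpace ℝ (Fin 2)) :=
  (gaussianReal 0 N.toNNReal).prod (multivariateGaussian 0 KW)

/-- A blocklength-`n` feedback code. Transmitter `ν` has `M ν` messages; its input at time `t` is
`enc ν t m v`, where `m` is its message and `v` lists its feedback outputs at the times before `t`.
The receiver decodes from all `n` channel outputs. -/
structure FeedbackCode (n : ℕ) where
  M : Fin 2 → ℕ
  M_pos : ∀ ν, 0 < M ν
  enc : (ν : Fin 2) → (t : Fin n) → Fin (M ν) → (Fin (t : ℕ) → ℝ) → ℝ
  measurable_enc : ∀ ν t m, Measurable (enc ν t m)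
  dec : (Fin n → ℝ) → ((ν : Fin 2) → Fin (M ν))
  measurable_dec : Measurable dec

namespace FeedbackCode

variable {n : ℕ} (c : FeedbackCode n)

/-- A sample point: the two messages, and the noise `(Z_t, (W_{1,t}, W_{2,t}))` at every time. -/
abbrev Sample : Type :=
  ((ν : Fin 2) → Fin (c.M ν)) × (Fin n → ℝ × EuclideanSpace ℝ (Fin 2))

/-- The law of a sample: independent and uniform messages, independent of the IID noise. -/
def law (N : ℝ) (KW : Matrix (Fin 2) (Fin 2) ℝ) : Measure c.Sample :=
  (Measure.pi fun ν => uniformOn (Set.univ : Set (Fin (c.M ν)))).prod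
    (Measure.pi fun _ : Fin n => noiseLaw N KW)

/-- The channel output `Y_t = X_{1,t} + X_{2,t} + Z_t`, where `X_{ν,t}` is computed from the message
`M_ν` and the earlier feedback outputs `V_{ν,s} = Y_s + W_{ν,s}`, `s < t`. -/
def output (ω : c.Sample) (t : Fin n) : ℝ :=
  (∑ ν : Fin 2, c.enc ν t (ω.1 ν) fun s : Fin (t : ℕ) =>
    output ω ⟨s, s.2.trans t.2⟩ + (ω.2 ⟨s, s.2.trans t.2⟩).2 ν) + (ω.2 t).1
termination_by (t : ℕ)
decreasing_by exact s.2

/-- The feedback output `V_{ν,t} = Y_t + W_{ν,t}`. -/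
def feedback (ω : c.Sample) (ν : Fin 2) (t : Fin n) : ℝ :=
  c.output ω t + (ω.2 t).2 ν

/-- The channel input `X_{ν,t}`. -/
def input (ω : c.Sample) (ν : Fin 2) (t : Fin n) : ℝ :=
  c.enc ν t (ω.1 ν) fun s : Fin (t : ℕ) => c.feedback ω ν ⟨s, s.2.trans t.2⟩

theorem output_eq (ω : c.Sample) (t : Fin n) :
    c.output ω t = c.input ω 0 t + c.input ω 1 t + (ω.2 t).1 := by
  rw [output, Fin.sum_univ_two]
  rfl

/-- The expected average block-power constraint `(1/n) ∑_t E[X_{ν,t}²] ≤ P` for Transmitter `ν`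
(the expectations being finite). -/
def SatisfiesPower (N : ℝ) (KW : Matrix (Fin 2) (Fin 2) ℝ) (ν : Fin 2) (P : ℝ) : Prop :=
  (∀ t, Integrable (fun ω => c.input ω ν t ^ 2) (c.law N KW)) ∧
    (1 / (n : ℝ)) * ∑ t, ∫ ω, c.input ω ν t ^ 2 ∂(c.law N KW) ≤ P

/-- The rate `(1/n) log |𝓜_ν|`. -/
def rate (ν : Fin 2) : ℝ := (1 / (n : ℝ)) * Real.log (c.M ν)

/-- The average probability of a decoding error. -/
def errorProb (N : ℝ) (KW : Matrix (Fin 2) (Fin 2) ℝ) : ℝ :=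
  (c.law N KW).real {ω | c.dec (c.output ω) ≠ ω.1}

end FeedbackCode

/-- A rate pair is achievable if for every `δ > 0` there are feedback codes satisfying the power
constraints and having rates exceeding `R₁ - δ` and `R₂ - δ`, for all sufficiently large
blocklengths, whose error probabilities tend to zero. -/
def Achievable (P₁ P₂ N : ℝ) (KW : Matrix (Fin 2) (Fin 2) ℝ) (R : ℝ × ℝ) : Prop :=
  ∀ δ > 0, ∃ c : (n : ℕ) → FeedbackCode n,
    (∀ᶠ n in atTop,
      (c n).SatisfiesPower N KW 0 P₁ ∧ (c n).SatisfiesPower N KW 1 P₂ ∧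
        R.1 - δ < (c n).rate 0 ∧ R.2 - δ < (c n).rate 1) ∧
    Tendsto (fun n => (c n).errorProb N KW) atTop (𝓝 0)

/-- The capacity region: the set of all achievable (nonnegative) rate pairs. -/
def capacityNoisyFB (P₁ P₂ N : ℝ) (KW : Matrix (Fin 2) (Fin 2) ℝ) : Set (ℝ × ℝ) :=
  {R | 0 ≤ R.1 ∧ 0 ≤ R.2 ∧ Achievable P₁ P₂ N KW R}

/-! ## The region `R(P₁, P₂, N, KW)`

Block matrices with `2η` rows or columns are indexed by `Fin 2 × Fin η`, the first component being
the number of the block; this is also the index type of `KW ⊗ I_η`. -/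

section Region

variable {η : ℕ}

/-- `(a₁ a₂)`, of size `η × 2`. -/
def Ab (a₁ a₂ : Fin η → ℝ) : Matrix (Fin η) (Fin 2) ℝ :=
  Matrix.of fun i ν => ![a₁, a₂] ν i

/-- `diag(a₁, a₂)`, of size `2η × 2`. -/
def Ad (a₁ a₂ : Fin η → ℝ) : Matrix (Fin 2 × Fin η) (Fin 2) ℝ :=
  Matrix.of fun p μ => if p.1 = μ then ![a₁, a₂] p.1 p.2 else 0

/-- `(B₁ B₂)`, of size `η × 2η`. -/
def Bb (B₁ B₂ : Matrix (Fin η) (Fin η) ℝ) : Matrix (Fin η) (Fin 2 × Fin η) ℝ :=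
  Matrix.of fun i q => ![B₁, B₂] q.1 i q.2

/-- `(B₁; B₂)` (stacked vertically), of size `2η × η`. -/
def Bt (B₁ B₂ : Matrix (Fin η) (Fin η) ℝ) : Matrix (Fin 2 × Fin η) (Fin η) ℝ :=
  Matrix.of fun p j => ![B₁, B₂] p.1 p.2 j

/-- `diag(B₁, B₂)`, of size `2η × 2η`. -/
def Bd (B₁ B₂ : Matrix (Fin η) (Fin η) ℝ) : Matrix (Fin 2 × Fin η) (Fin 2 × Fin η) ℝ :=
  Matrix.of fun p q => if p.1 = q.1 then ![B₁, B₂] p.1 p.2 q.2 else 0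

/-- `(B₁ B₁; B₂ B₂)`, of size `2η × 2η`. -/
def BB (B₁ B₂ : Matrix (Fin η) (Fin η) ℝ) : Matrix (Fin 2 × Fin η) (Fin 2 × Fin η) ℝ :=
  Matrix.of fun p q => ![B₁, B₂] p.1 p.2 q.2

/-- `N I_η + (B₁ B₂) (KW ⊗ I_η) (B₁ B₂)ᵀ`. -/
def noiseCov (N : ℝ) (KW : Matrix (Fin 2) (Fin 2) ℝ) (B₁ B₂ : Matrix (Fin η) (Fin η) ℝ) :
    Matrix (Fin η) (Fin η) ℝ :=
  N • (1 : Matrix (Fin η) (Fin η) ℝ) +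
    Bb B₁ B₂ * (KW ⊗ₖ (1 : Matrix (Fin η) (Fin η) ℝ)) * (Bb B₁ B₂).transpose

/-- `(1/(2η)) log ( |C (S + Σ) Cᵀ| / |C Σ Cᵀ| )`, with `Σ = noiseCov N KW B₁ B₂`. -/
def rateBound {m : Type} [Fintype m] [DecidableEq m] (N : ℝ) (KW : Matrix (Fin 2) (Fin 2) ℝ)
    (B₁ B₂ : Matrix (Fin η) (Fin η) ℝ) (C : Matrix m (Fin η) ℝ) (S : Matrix (Fin η) (Fin η) ℝ) :
    ℝ :=
  1 / (2 * (η : ℝ)) *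
    Real.log ((C * (S + noiseCov N KW B₁ B₂) * C.transpose).det /
      (C * noiseCov N KW B₁ B₂ * C.transpose).det)

/-- The nonnegative rate pairs satisfying the three log-determinant rate constraints. -/
def logDetRegion {m : Type} [Fintype m] [DecidableEq m] (N : ℝ) (KW : Matrix (Fin 2) (Fin 2) ℝ)
    (a₁ a₂ : Fin η → ℝ) (B₁ B₂ : Matrix (Fin η) (Fin η) ℝ) (C : Matrix m (Fin η) ℝ) :
    Set (ℝ × ℝ) :=
  {R | 0 ≤ R.1 ∧ 0 ≤ R.2 ∧
    R.1 ≤ rateBound N KW B₁ B₂ C (Matrix.vecMulVec a₁ a₁) ∧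
    R.2 ≤ rateBound N KW B₁ B₂ C (Matrix.vecMulVec a₂ a₂) ∧
    R.1 + R.2 ≤ rateBound N KW B₁ B₂ C (Ab a₁ a₂ * (Ab a₁ a₂).transpose)}

open Classical in
/-- The region `R_{N,KW}(η, a₁, a₂, B₁, B₂, C)`: if `C Cᵀ` is nonsingular, it is given by the
constraints for `C`; if `C Cᵀ` is singular and `C ≠ 0`, by the constraints for a nonzero row of
`C` (the rows being then proportional, all nonzero rows give the same constraints); and for `C = 0`
it is the origin. -/
def paramRegion (N : ℝ) (KW : Matrix (Fin 2) (Fin 2) ℝ) (a₁ a₂ : Fin η → ℝ)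
    (B₁ B₂ : Matrix (Fin η) (Fin η) ℝ) (C : Matrix (Fin 2) (Fin η) ℝ) : Set (ℝ × ℝ) :=
  if IsUnit (C * C.transpose) then logDetRegion N KW a₁ a₂ B₁ B₂ C
  else if C ≠ 0 then
    {R | ∃ i, C i ≠ 0 ∧ R ∈ logDetRegion N KW a₁ a₂ B₁ B₂ (Matrix.replicateRow Unit (C i))}
  else {(0, 0)}

/-- `(I - BB)⁻¹ (Ad Adᵀ + N Bt Btᵀ + Bd (KW ⊗ I_η) Bdᵀ) (I - BB)⁻ᵀ`. -/
def inputCov (N : ℝ) (KW : Matrix (Fin 2) (Fin 2) ℝ) (a₁ a₂ : Fin η → ℝ)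
    (B₁ B₂ : Matrix (Fin η) (Fin η) ℝ) : Matrix (Fin 2 × Fin η) (Fin 2 × Fin η) ℝ :=
  (1 - BB B₁ B₂)⁻¹ *
    (Ad a₁ a₂ * (Ad a₁ a₂).transpose + N • (Bt B₁ B₂ * (Bt B₁ B₂).transpose) +
      Bd B₁ B₂ * (KW ⊗ₖ (1 : Matrix (Fin η) (Fin η) ℝ)) * (Bd B₁ B₂).transpose) *
    ((1 - BB B₁ B₂)⁻¹).transpose

/-- The `ν`-th diagonal `η × η` block of a `2η × 2η` matrix; that is `(I 0) M (I 0)ᵀ` for the first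
transmitter and `(0 I) M (0 I)ᵀ` for the second one. -/
def diagBlock (M : Matrix (Fin 2 × Fin η) (Fin 2 × Fin η) ℝ) (ν : Fin 2) :
    Matrix (Fin η) (Fin η) ℝ :=
  M.submatrix (fun i => (ν, i)) (fun i => (ν, i))

/-- The two trace constraints. -/
def TraceConstraints (P₁ P₂ N : ℝ) (KW : Matrix (Fin 2) (Fin 2) ℝ) (a₁ a₂ : Fin η → ℝ)
    (B₁ B₂ : Matrix (Fin η) (Fin η) ℝ) : Prop :=
  (diagBlock (inputCov N KW a₁ a₂ B₁ B₂) 0).trace ≤ η * P₁ ∧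
    (diagBlock (inputCov N KW a₁ a₂ B₁ B₂) 1).trace ≤ η * P₂

/-- Strictly lower-triangular matrices. -/
def StrictlyLower (B : Matrix (Fin η) (Fin η) ℝ) : Prop :=
  ∀ i j, i ≤ j → B i j = 0

end Region

/-- The region `R(P₁, P₂, N, KW)`. -/
def region (P₁ P₂ N : ℝ) (KW : Matrix (Fin 2) (Fin 2) ℝ) : Set (ℝ × ℝ) :=
  closure {R | ∃ (η : ℕ) (a₁ a₂ : Fin η → ℝ) (B₁ B₂ : Matrix (Fin η) (Fin η) ℝ)
    (C : Matrix (Fin 2) (Fin η) ℝ), 0 < η ∧ StrictlyLower B₁ ∧ StrictlyLower B₂ ∧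
      TraceConstraints P₁ P₂ N KW a₁ a₂ B₁ B₂ ∧ R ∈ paramRegion N KW a₁ a₂ B₁ B₂ C}

end

end NoisyFBMAC

/-! Time is cut into blocks of `η` channel uses. In each block Transmitter `ν` sends one real code
symbol `x_ν` along `a_ν` and adds `B_ν` applied to its feedback from the same block. The receiver
knows `Y`, so it can subtract `(B₁ + B₂) Y`; what is left is `x₁ a₁ + x₂ a₂ + U`, where `U = Z + B₁
W₁ + B₂ W₂` has covariance `Σ` (`stripFeedback_output`). The feedback has disappeared: there remains
a multiple-access channel that is memoryless across blocks, and random coding with independent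
Gaussian symbols of variance `s < 1` applies to it.

The decoder of `exists_code_of_likelihood` looks for the only message pair that passes three
threshold tests. A wrong codeword is independent of the output, so the union bound needs only that
each test function has a small integral over the codeword for every fixed output; the transmitted
pair passes by the law of large numbers. Hence the true output densities are never needed.
`exists_infoDensities` compares the Gaussian density centred at a linear estimate of the symbol with
the prior density of the symbol. The mean of such a log-ratio depends on the noise only through
second moments, and for the best linear estimate from `C` times the output it is half the
log-determinant ratio (`exists_linear_estimator`). The density for the sum rate comes from the chain
rule: user 1 with user 2 treated as noise, then user 2 given user 1.

The power constraints must hold for the chosen codebook, not only on average over codebooks. The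
inputs are a signal part plus an independent centred noise part (`input_linearCode`), so their
powers add, and the trace of `Q` splits in the same way. The deviation of the empirical signal
energy from its mean enters the random-coding average as a cost next to the error probability, so
one codebook makes both small (`exists_vanishing_codes`); the slack left by `s < 1` absorbs the
deviation (`average_power_le`). Letting `s` tend to `1` by continuity of the log-determinants, and
using that the capacity region is closed, gives the claim. -/

namespace NoisyFBMAC

open scoped ENNReal Matrix

/-! ### One-shot random coding for a two-user channel with a cost -/

section OneShot

theorem lintegral_pi_eval {ι X : Type*} [Fintype ι] [MeasurableSpace X] (p : Measure X)
    [IsProbabilityMeasure p] (i : ι) {φ : X → ℝ≥0∞} (hφ : Measurable φ) :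
    ∫⁻ c, φ (c i) ∂(Measure.pi fun _ : ι => p) = ∫⁻ x, φ x ∂p :=
  (measurePreserving_eval (fun _ : ι => p) i).lintegral_comp hφ

theorem lintegral_pi_eval_eval {ι X : Type*} [Fintype ι] [MeasurableSpace X] (p : Measure X)
    [IsProbabilityMeasure p] {i j : ι} (hij : i ≠ j) {φ : X × X → ℝ≥0∞} (hφ : Measurable φ) :
    ∫⁻ c, φ (c i, c j) ∂(Measure.pi fun _ : ι => p) = ∫⁻ x, ∫⁻ x', φ (x, x') ∂p ∂p := by
  have hind : IndepFun (fun c : ι → X => c i) (fun c => c j) (Measure.pi fun _ : ι => p) :=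
    (iIndepFun_pi (μ := fun _ : ι => p) (X := fun _ x => x)
      fun _ => measurable_id.aemeasurable).indepFun hij
  have hmap := (indepFun_iff_map_prod_eq_prod_map_map (measurable_pi_apply i).aemeasurable
    (measurable_pi_apply j).aemeasurable).1 hind
  have he : ∀ l : ι, Measure.map (fun c : ι → X => c l) (Measure.pi fun _ : ι => p) = p :=
    fun l => (measurePreserving_eval (fun _ : ι => p) l).map_eq
  rw [he, he] at hmap
  rw [← lintegral_prod _ hφ.aemeasurable, ← hmap,
    lintegral_map hφ ((measurable_pi_apply i).prodMk (measurable_pi_apply j))]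

open Classical in
/-- The unique element satisfying a predicate, if there is one. -/
noncomputable def pickUnique {M : Type*} [Nonempty M] (S : M → Prop) : M :=
  if h : ∃ m, S = fun m' => m' = m then h.choose else Classical.arbitrary M

theorem pickUnique_eq {M : Type*} [Nonempty M] {S : M → Prop} {m : M} (hm : S m)
    (h : ∀ m', m' ≠ m → ¬ S m') : pickUnique S = m := by
  have hS : ∃ m, S = fun m' => m' = m :=
    ⟨m, funext fun m' => propext ⟨fun h' => by_contra fun hne => h m' hne h', fun h' => h' ▸ hm⟩⟩
  have h2 := hS.choose_spec
  rw [pickUnique, dif_pos hS]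
  rw [h2] at hm
  exact hm.symm

theorem measurable_pickUnique {M Y : Type*} [Finite M] [Nonempty M] [MeasurableSpace M]
    [MeasurableSpace Y] {S : Y → M → Prop} (hS : ∀ m, MeasurableSet {y | S y m}) :
    Measurable fun y => pickUnique (S y) := by
  have h1 : Measurable S := measurable_pi_iff.2 fun m => measurableSet_setOfPred.1 (hS m)
  -- The selection factors through the finite discrete space `M → Prop`, where every map is
  -- measurable.
  have h2 : Measurable (pickUnique : (M → Prop) → M) := by
    have := Fintype.ofFinite M
    exact Measurable.of_discrete
  exact h2.comp h1

variable {X₁ X₂ Y Ω I K : Type*} [Fintype I] [Fintype K]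

/-- The union bound on the error probability of the threshold decoder. -/
theorem one_le_of_pickUnique_ne [DecidableEq I] [DecidableEq K] [Nonempty I] [Nonempty K]
    {J₁ J₂ J₁₂ : X₁ × X₂ × Y → ℝ≥0∞} (c₁ : I → X₁) (c₂ : K → X₂) (y : Y) (m : I × K)
    (hne : pickUnique (fun m : I × K => 1 ≤ J₁ (c₁ m.1, c₂ m.2, y) ∧ 1 ≤ J₂ (c₁ m.1, c₂ m.2, y) ∧
      1 ≤ J₁₂ (c₁ m.1, c₂ m.2, y)) ≠ m) :
    1 ≤ Set.indicator {q : X₁ × X₂ × Y | ¬ (1 ≤ J₁ q ∧ 1 ≤ J₂ q ∧ 1 ≤ J₁₂ q)} 1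
          (c₁ m.1, c₂ m.2, y) +
        (∑ i ∈ Finset.univ.erase m.1, J₁ (c₁ i, c₂ m.2, y) +
        (∑ j ∈ Finset.univ.erase m.2, J₂ (c₁ m.1, c₂ j, y) +
        ∑ i ∈ Finset.univ.erase m.1, ∑ j ∈ Finset.univ.erase m.2, J₁₂ (c₁ i, c₂ j, y))) := by
  by_cases hm : 1 ≤ J₁ (c₁ m.1, c₂ m.2, y) ∧ 1 ≤ J₂ (c₁ m.1, c₂ m.2, y) ∧
      1 ≤ J₁₂ (c₁ m.1, c₂ m.2, y)
  · by_cases h : ∀ m' : I × K, m' ≠ m → ¬ (1 ≤ J₁ (c₁ m'.1, c₂ m'.2, y) ∧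
        1 ≤ J₂ (c₁ m'.1, c₂ m'.2, y) ∧ 1 ≤ J₁₂ (c₁ m'.1, c₂ m'.2, y))
    · exact absurd (pickUnique_eq (S := fun m : I × K => 1 ≤ J₁ (c₁ m.1, c₂ m.2, y) ∧
        1 ≤ J₂ (c₁ m.1, c₂ m.2, y) ∧ 1 ≤ J₁₂ (c₁ m.1, c₂ m.2, y)) hm h) hne
    -- The true pair passes, so a wrong pair passes too. It errs in the first component only, the
    -- second only, or both, and is charged to `J₁`, `J₂` or `J₁₂` respectively.
    · push Not at h
      obtain ⟨⟨i, j⟩, hij, h1, h2, h12⟩ := h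
      by_cases hi : i = m.1
      · have hj : j ≠ m.2 := fun hj => hij (Prod.ext hi hj)
        subst hi
        refine h2.trans (le_trans ?_ (le_add_left (le_add_left le_self_add)))
        exact Finset.single_le_sum (f := fun j => J₂ (c₁ m.1, c₂ j, y)) (fun _ _ => zero_le)
          (Finset.mem_erase.2 ⟨hj, Finset.mem_univ _⟩)
      · by_cases hj : j = m.2
        · subst hj
          refine h1.trans (le_trans ?_ (le_add_left le_self_add))
          exact Finset.single_le_sum (f := fun i => J₁ (c₁ i, c₂ m.2, y)) (fun _ _ => zero_le)
            (Finset.mem_erase.2 ⟨hi, Finset.mem_univ _⟩)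
        · refine h12.trans (le_trans ?_ (le_add_left (le_add_left le_add_self)))
          refine le_trans ?_ (Finset.single_le_sum
            (f := fun i => ∑ j ∈ Finset.univ.erase m.2, J₁₂ (c₁ i, c₂ j, y)) (fun _ _ => zero_le)
            (Finset.mem_erase.2 ⟨hi, Finset.mem_univ _⟩))
          exact Finset.single_le_sum (f := fun j => J₁₂ (c₁ i, c₂ j, y)) (fun _ _ => zero_le)
            (Finset.mem_erase.2 ⟨hj, Finset.mem_univ _⟩)
  · refine le_trans ?_ le_self_add
    rw [Set.indicator_of_mem (by exact hm)]
    rfl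

variable [MeasurableSpace X₁] [MeasurableSpace X₂] [MeasurableSpace Y] [MeasurableSpace Ω]
  {p₁ : Measure X₁} {p₂ : Measure X₂} {ν : Measure Ω} [IsProbabilityMeasure p₁]
  [IsProbabilityMeasure p₂] [IsProbabilityMeasure ν] {h : X₁ × X₂ × Ω → Y}

theorem lintegral_codebooks_eval (m : I × K) {φ : X₁ × X₂ × Ω → ℝ≥0∞} (hφ : Measurable φ) :
    ∫⁻ c₁, ∫⁻ c₂, ∫⁻ ω, φ (c₁ m.1, c₂ m.2, ω) ∂ν ∂(Measure.pi fun _ : K => p₂)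
      ∂(Measure.pi fun _ : I => p₁) = ∫⁻ x₁, ∫⁻ x₂, ∫⁻ ω, φ (x₁, x₂, ω) ∂ν ∂p₂ ∂p₁ := by
  have h2 (x₁ : X₁) := lintegral_pi_eval p₂ m.2 (φ := fun x₂ => ∫⁻ ω, φ (x₁, x₂, ω) ∂ν)
    (by fun_prop)
  simp_rw [h2]
  exact lintegral_pi_eval p₁ m.1 (φ := fun x₁ => ∫⁻ x₂, ∫⁻ ω, φ (x₁, x₂, ω) ∂ν ∂p₂) (by fun_prop)

/-- The competing codeword `c₁ i` is independent of everything that determines the output, so it can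
be integrated out first, with the other codeword and the output frozen; this is why `hε` is required
uniformly in them. The two lemmas below treat the other error types in the same way. -/
theorem lintegral_codebooks_fst_le (hh : Measurable h) {J : X₁ × X₂ × Y → ℝ≥0∞} (hJ : Measurable J)
    {ε : ℝ≥0∞} (hε : ∀ x₂ y, ∫⁻ x, J (x, x₂, y) ∂p₁ ≤ ε) (m : I × K) {i : I} (hi : i ≠ m.1) :
    ∫⁻ c₁, ∫⁻ c₂, ∫⁻ ω, J (c₁ i, c₂ m.2, h (c₁ m.1, c₂ m.2, ω)) ∂ν
      ∂(Measure.pi fun _ : K => p₂) ∂(Measure.pi fun _ : I => p₁) ≤ ε := by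
  have h2 (c₁ : I → X₁) := lintegral_pi_eval p₂ m.2
    (φ := fun x₂ => ∫⁻ ω, J (c₁ i, x₂, h (c₁ m.1, x₂, ω)) ∂ν) (by fun_prop)
  simp_rw [h2]
  rw [lintegral_pi_eval_eval p₁ hi.symm
    (φ := fun x => ∫⁻ x₂, ∫⁻ ω, J (x.2, x₂, h (x.1, x₂, ω)) ∂ν ∂p₂) (by fun_prop)]
  calc ∫⁻ x, ∫⁻ x', ∫⁻ x₂, ∫⁻ ω, J (x', x₂, h (x, x₂, ω)) ∂ν ∂p₂ ∂p₁ ∂p₁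
      = ∫⁻ x, ∫⁻ x₂, ∫⁻ ω, ∫⁻ x', J (x', x₂, h (x, x₂, ω)) ∂p₁ ∂ν ∂p₂ ∂p₁ := by
        refine lintegral_congr fun x => ?_
        rw [lintegral_lintegral_swap (by fun_prop)]
        refine lintegral_congr fun x₂ => ?_
        rw [lintegral_lintegral_swap (by fun_prop)]
    _ ≤ ∫⁻ x, ∫⁻ x₂, ∫⁻ ω, ε ∂ν ∂p₂ ∂p₁ := by
        gcongr
        exact hε _ _
    _ = ε := by simp

theorem lintegral_codebooks_snd_le (hh : Measurable h) {J : X₁ × X₂ × Y → ℝ≥0∞} (hJ : Measurable J)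
    {ε : ℝ≥0∞} (hε : ∀ x₁ y, ∫⁻ x, J (x₁, x, y) ∂p₂ ≤ ε) (m : I × K) {j : K} (hj : j ≠ m.2) :
    ∫⁻ c₁, ∫⁻ c₂, ∫⁻ ω, J (c₁ m.1, c₂ j, h (c₁ m.1, c₂ m.2, ω)) ∂ν
      ∂(Measure.pi fun _ : K => p₂) ∂(Measure.pi fun _ : I => p₁) ≤ ε := by
  have h2 (c₁ : I → X₁) := lintegral_pi_eval_eval p₂ hj.symm
    (φ := fun x => ∫⁻ ω, J (c₁ m.1, x.2, h (c₁ m.1, x.1, ω)) ∂ν) (by fun_prop)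
  simp_rw [h2]
  rw [lintegral_pi_eval p₁ m.1
    (φ := fun x₁ => ∫⁻ x, ∫⁻ x', ∫⁻ ω, J (x₁, x', h (x₁, x, ω)) ∂ν ∂p₂ ∂p₂) (by fun_prop)]
  calc ∫⁻ x₁, ∫⁻ x, ∫⁻ x', ∫⁻ ω, J (x₁, x', h (x₁, x, ω)) ∂ν ∂p₂ ∂p₂ ∂p₁
      = ∫⁻ x₁, ∫⁻ x, ∫⁻ ω, ∫⁻ x', J (x₁, x', h (x₁, x, ω)) ∂p₂ ∂ν ∂p₂ ∂p₁ := by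
        refine lintegral_congr fun x₁ => lintegral_congr fun x => ?_
        rw [lintegral_lintegral_swap (by fun_prop)]
    _ ≤ ∫⁻ x₁, ∫⁻ x, ∫⁻ ω, ε ∂ν ∂p₂ ∂p₁ := by
        gcongr
        exact hε _ _
    _ = ε := by simp

theorem lintegral_codebooks_both_le (hh : Measurable h) {J : X₁ × X₂ × Y → ℝ≥0∞}
    (hJ : Measurable J) {ε : ℝ≥0∞} (hε : ∀ y, ∫⁻ x₁, ∫⁻ x₂, J (x₁, x₂, y) ∂p₂ ∂p₁ ≤ ε) (m : I × K)
    {i : I} (hi : i ≠ m.1) {j : K} (hj : j ≠ m.2) :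
    ∫⁻ c₁, ∫⁻ c₂, ∫⁻ ω, J (c₁ i, c₂ j, h (c₁ m.1, c₂ m.2, ω)) ∂ν
      ∂(Measure.pi fun _ : K => p₂) ∂(Measure.pi fun _ : I => p₁) ≤ ε := by
  have h2 (c₁ : I → X₁) := lintegral_pi_eval_eval p₂ hj.symm
    (φ := fun x => ∫⁻ ω, J (c₁ i, x.2, h (c₁ m.1, x.1, ω)) ∂ν) (by fun_prop)
  simp_rw [h2]
  rw [lintegral_pi_eval_eval p₁ hi.symm
    (φ := fun x => ∫⁻ u, ∫⁻ u', ∫⁻ ω, J (x.2, u', h (x.1, u, ω)) ∂ν ∂p₂ ∂p₂) (by fun_prop)]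
  calc ∫⁻ x, ∫⁻ x', ∫⁻ u, ∫⁻ u', ∫⁻ ω, J (x', u', h (x, u, ω)) ∂ν ∂p₂ ∂p₂ ∂p₁ ∂p₁
      = ∫⁻ x, ∫⁻ u, ∫⁻ ω, ∫⁻ x', ∫⁻ u', J (x', u', h (x, u, ω)) ∂p₂ ∂p₁ ∂ν ∂p₂ ∂p₁ := by
        refine lintegral_congr fun x => ?_
        rw [lintegral_lintegral_swap (by fun_prop)]
        refine lintegral_congr fun u => ?_
        have h3 (x' : X₁) : ∫⁻ u', ∫⁻ ω, J (x', u', h (x, u, ω)) ∂ν ∂p₂ =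
            ∫⁻ ω, ∫⁻ u', J (x', u', h (x, u, ω)) ∂p₂ ∂ν :=
          lintegral_lintegral_swap (by fun_prop)
        simp_rw [h3]
        rw [lintegral_lintegral_swap (by fun_prop)]
    _ ≤ ∫⁻ x, ∫⁻ u, ∫⁻ ω, ε ∂ν ∂p₂ ∂p₁ := by
        gcongr
        exact hε _
    _ = ε := by simp

/-- Random coding for a two-user channel with additional average cost, in terms of functions
`J₁, J₂, J₁₂` that play the role of normalized likelihood ratios. -/
theorem exists_code_of_likelihood [Nonempty I] [Nonempty K] [MeasurableSpace I] [MeasurableSpace K]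
    [DiscreteMeasurableSpace (I × K)] (hh : Measurable h)
    {J₁ J₂ J₁₂ : X₁ × X₂ × Y → ℝ≥0∞} (hJ₁ : Measurable J₁) (hJ₂ : Measurable J₂)
    (hJ₁₂ : Measurable J₁₂) {ε₁ ε₂ ε₁₂ : ℝ≥0∞}
    (h₁ : ∀ x₂ y, ∫⁻ x, J₁ (x, x₂, y) ∂p₁ ≤ ε₁) (h₂ : ∀ x₁ y, ∫⁻ x, J₂ (x₁, x, y) ∂p₂ ≤ ε₂)
    (h₁₂ : ∀ y, ∫⁻ x₁, ∫⁻ x₂, J₁₂ (x₁, x₂, y) ∂p₂ ∂p₁ ≤ ε₁₂)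
    {cost : X₁ × X₂ → ℝ≥0∞} (hcost : Measurable cost) {w : I × K → ℝ≥0∞} (hw : ∑ m, w m = 1) :
    ∃ (c₁ : I → X₁) (c₂ : K → X₂) (dec : Y → I × K), Measurable dec ∧
      ∑ m, w m * (ν {ω | dec (h (c₁ m.1, c₂ m.2, ω)) ≠ m} + cost (c₁ m.1, c₂ m.2)) ≤
        (∫⁻ x₁, ∫⁻ x₂, ν {ω | ¬ (1 ≤ J₁ (x₁, x₂, h (x₁, x₂, ω)) ∧
          1 ≤ J₂ (x₁, x₂, h (x₁, x₂, ω)) ∧ 1 ≤ J₁₂ (x₁, x₂, h (x₁, x₂, ω)))} ∂p₂ ∂p₁) +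
        (((Fintype.card I - 1 : ℕ) : ℝ≥0∞) * ε₁ + (((Fintype.card K - 1 : ℕ) : ℝ≥0∞) * ε₂ +
          ((Fintype.card I - 1 : ℕ) : ℝ≥0∞) * (((Fintype.card K - 1 : ℕ) : ℝ≥0∞) * ε₁₂))) +
        ∫⁻ x₁, ∫⁻ x₂, cost (x₁, x₂) ∂p₂ ∂p₁ := by
  classical
  set P₁ := Measure.pi fun _ : I => p₁
  set P₂ := Measure.pi fun _ : K => p₂
  set bad : Set (X₁ × X₂ × Y) := {q | ¬ (1 ≤ J₁ q ∧ 1 ≤ J₂ q ∧ 1 ≤ J₁₂ q)} with hbad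
  have hbadm : MeasurableSet bad :=
    ((measurableSet_le measurable_const hJ₁).inter ((measurableSet_le measurable_const hJ₂).inter
      (measurableSet_le measurable_const hJ₁₂))).compl
  have hind : Measurable (bad.indicator (1 : X₁ × X₂ × Y → ℝ≥0∞)) :=
    measurable_one.indicator hbadm
  set err : (I → X₁) → (K → X₂) → I × K → Ω → ℝ≥0∞ := fun c₁ c₂ m ω =>
    bad.indicator 1 (c₁ m.1, c₂ m.2, h (c₁ m.1, c₂ m.2, ω)) +
        (∑ i ∈ Finset.univ.erase m.1, J₁ (c₁ i, c₂ m.2, h (c₁ m.1, c₂ m.2, ω)) +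
        (∑ j ∈ Finset.univ.erase m.2, J₂ (c₁ m.1, c₂ j, h (c₁ m.1, c₂ m.2, ω)) +
        ∑ i ∈ Finset.univ.erase m.1, ∑ j ∈ Finset.univ.erase m.2,
          J₁₂ (c₁ i, c₂ j, h (c₁ m.1, c₂ m.2, ω)))) with herr
  set B := (∫⁻ x₁, ∫⁻ x₂, ν {ω | ¬ (1 ≤ J₁ (x₁, x₂, h (x₁, x₂, ω)) ∧
          1 ≤ J₂ (x₁, x₂, h (x₁, x₂, ω)) ∧ 1 ≤ J₁₂ (x₁, x₂, h (x₁, x₂, ω)))} ∂p₂ ∂p₁) +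
        (((Fintype.card I - 1 : ℕ) : ℝ≥0∞) * ε₁ + (((Fintype.card K - 1 : ℕ) : ℝ≥0∞) * ε₂ +
          ((Fintype.card I - 1 : ℕ) : ℝ≥0∞) * (((Fintype.card K - 1 : ℕ) : ℝ≥0∞) * ε₁₂))) with hB
  set D := ∫⁻ x₁, ∫⁻ x₂, cost (x₁, x₂) ∂p₂ ∂p₁ with hD
  have hprod (φ : ((I → X₁) × (K → X₂)) × Ω → ℝ≥0∞) (hφ : Measurable φ) :
      ∫⁻ q, φ q ∂((P₁.prod P₂).prod ν) = ∫⁻ c₁, ∫⁻ c₂, ∫⁻ ω, φ ((c₁, c₂), ω) ∂ν ∂P₂ ∂P₁ := by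
    rw [lintegral_prod _ hφ.aemeasurable, lintegral_prod _ hφ.lintegral_prod_right'.aemeasurable]
  have hEerr (m : I × K) : ∫⁻ c₁, ∫⁻ c₂, ∫⁻ ω, err c₁ c₂ m ω ∂ν ∂P₂ ∂P₁ ≤ B := by
    have e1 : ∫⁻ c₁, ∫⁻ c₂, ∫⁻ ω, bad.indicator 1 (c₁ m.1, c₂ m.2, h (c₁ m.1, c₂ m.2, ω)) ∂ν
        ∂P₂ ∂P₁ = ∫⁻ x₁, ∫⁻ x₂, ν {ω | ¬ (1 ≤ J₁ (x₁, x₂, h (x₁, x₂, ω)) ∧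
          1 ≤ J₂ (x₁, x₂, h (x₁, x₂, ω)) ∧ 1 ≤ J₁₂ (x₁, x₂, h (x₁, x₂, ω)))} ∂p₂ ∂p₁ := by
      rw [lintegral_codebooks_eval m
        (φ := fun q => bad.indicator 1 (q.1, q.2.1, h (q.1, q.2.1, q.2.2))) (by fun_prop)]
      refine lintegral_congr fun x₁ => lintegral_congr fun x₂ => ?_
      have hs : Measurable fun ω => (x₁, x₂, h (x₁, x₂, ω)) := by fun_prop
      exact lintegral_indicator_one (hs hbadm)
    have hcI : (Finset.univ.erase m.1).card = Fintype.card I - 1 := by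
      rw [Finset.card_erase_of_mem (Finset.mem_univ _), Finset.card_univ]
    have hcK : (Finset.univ.erase m.2).card = Fintype.card K - 1 := by
      rw [Finset.card_erase_of_mem (Finset.mem_univ _), Finset.card_univ]
    rw [← hprod (fun q => err q.1.1 q.1.2 m q.2) (by simp only [herr]; fun_prop)]
    simp only [herr]
    simp (discharger := fun_prop) only [lintegral_add_left, lintegral_finsetSum]
    simp (discharger := fun_prop) only [hprod]
    rw [e1, hB]
    refine add_le_add le_rfl (add_le_add ?_ (add_le_add ?_ ?_))
    · rw [← hcI, ← nsmul_eq_mul]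
      exact Finset.sum_le_card_nsmul _ _ _ fun i hi =>
        lintegral_codebooks_fst_le hh hJ₁ h₁ m (Finset.ne_of_mem_erase hi)
    · rw [← hcK, ← nsmul_eq_mul]
      exact Finset.sum_le_card_nsmul _ _ _ fun j hj =>
        lintegral_codebooks_snd_le hh hJ₂ h₂ m (Finset.ne_of_mem_erase hj)
    · rw [← hcK, ← hcI, ← nsmul_eq_mul, ← nsmul_eq_mul]
      exact Finset.sum_le_card_nsmul _ _ _ fun i hi => Finset.sum_le_card_nsmul _ _ _ fun j hj =>
        lintegral_codebooks_both_le hh hJ₁₂ h₁₂ m (Finset.ne_of_mem_erase hi)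
          (Finset.ne_of_mem_erase hj)
  have hEcost (m : I × K) : ∫⁻ c₁, ∫⁻ c₂, cost (c₁ m.1, c₂ m.2) ∂P₂ ∂P₁ = D := by
    have := lintegral_codebooks_eval (p₁ := p₁) (p₂ := p₂) (ν := ν) m
      (φ := fun q => cost (q.1, q.2.1)) (by fun_prop)
    simpa using this
  -- Error bound and cost are averaged together, so that a single codebook is good for both.
  set F : (I → X₁) × (K → X₂) → ℝ≥0∞ := fun c =>
    ∑ m, w m * (∫⁻ ω, err c.1 c.2 m ω ∂ν + cost (c.1 m.1, c.2 m.2)) with hF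
  have herrm (m : I × K) :
      Measurable fun q : ((I → X₁) × (K → X₂)) × Ω => err q.1.1 q.1.2 m q.2 := by
    simp only [herr]; fun_prop
  have hFm : Measurable F := by
    simp only [hF]
    refine Finset.measurable_sum _ fun m _ => Measurable.const_mul (Measurable.add ?_ ?_) _
    · exact (herrm m).lintegral_prod_right'
    · fun_prop
  have hEF : ∫⁻ c, F c ∂(P₁.prod P₂) ≤ B + D := by
    have hterm (m : I × K) :
        ∫⁻ c, w m * (∫⁻ ω, err c.1 c.2 m ω ∂ν + cost (c.1 m.1, c.2 m.2)) ∂(P₁.prod P₂) ≤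
          w m * (B + D) := by
      have hm1 : Measurable fun c : (I → X₁) × (K → X₂) => ∫⁻ ω, err c.1 c.2 m ω ∂ν :=
        (herrm m).lintegral_prod_right'
      have hm2 : Measurable fun c : (I → X₁) × (K → X₂) => cost (c.1 m.1, c.2 m.2) := by fun_prop
      rw [lintegral_const_mul _ (by exact hm1.add hm2), lintegral_add_left hm1,
        lintegral_prod _ hm1.aemeasurable, lintegral_prod _ hm2.aemeasurable, hEcost]
      gcongr
      exact hEerr m
    simp only [hF]
    rw [lintegral_finsetSum]
    · calc _ ≤ ∑ m, w m * (B + D) := Finset.sum_le_sum fun m _ => hterm m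
        _ = B + D := by rw [← Finset.sum_mul, hw, one_mul]
    · intro m _
      refine Measurable.const_mul (Measurable.add ?_ ?_) _
      · exact (herrm m).lintegral_prod_right'
      · fun_prop
  -- Some codebook is no worse than the average.
  obtain ⟨⟨c₁, c₂⟩, hc⟩ := exists_le_lintegral (μ := P₁.prod P₂) hFm.aemeasurable
  have hdec : Measurable fun y : Y => pickUnique fun m : I × K => 1 ≤ J₁ (c₁ m.1, c₂ m.2, y) ∧
      1 ≤ J₂ (c₁ m.1, c₂ m.2, y) ∧ 1 ≤ J₁₂ (c₁ m.1, c₂ m.2, y) := by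
    refine measurable_pickUnique fun m => ?_
    have hs : Measurable fun y : Y => (c₁ m.1, c₂ m.2, y) := by fun_prop
    exact (measurableSet_le measurable_const (hJ₁.comp hs)).inter
      ((measurableSet_le measurable_const (hJ₂.comp hs)).inter
      (measurableSet_le measurable_const (hJ₁₂.comp hs)))
  refine ⟨c₁, c₂, _, hdec, le_trans ?_ (hc.trans hEF)⟩
  refine Finset.sum_le_sum fun m _ => mul_le_mul_right ?_ (w m)
  refine add_le_add ?_ le_rfl
  -- Markov's inequality at level `1`: `err` is at least `1` wherever the decoder fails.
  have hm : Measurable fun ω => err c₁ c₂ m ω := by simp only [herr]; fun_prop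
  calc _ ≤ ν {ω | 1 ≤ err c₁ c₂ m ω} :=
        measure_mono fun ω hω => 
          one_le_of_pickUnique_ne c₁ c₂ (h (c₁ m.1, c₂ m.2, ω)) m hω
    _ ≤ ∫⁻ ω, err c₁ c₂ m ω ∂ν := by simpa using mul_meas_ge_le_lintegral hm 1

end OneShot

/-! ### Independent blocks: law of large numbers and rearrangement of product measures -/

section ProductMeasures

/-- The weak law of large numbers in `L¹`, on finite product spaces. -/
theorem tendsto_lintegral_pi_average {S : Type*} [MeasurableSpace S] (μ : Measure S)
    [IsProbabilityMeasure μ] {f : S → ℝ} (hf : Measurable f) (hfi : Integrable f μ) :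
    Tendsto (fun k : ℕ => ∫⁻ x, ‖(k : ℝ)⁻¹ * ∑ b, f (x b) - ∫ s, f s ∂μ‖ₑ
      ∂(Measure.pi fun _ : Fin k => μ)) atTop (𝓝 0) := by
  -- All the finite products are marginals of one infinite product, on which the `L¹` strong law
  -- applies.
  set P := Measure.infinitePi fun _ : ℕ => μ with hP
  have hlaw (i : ℕ) : Measure.map (fun x : ℕ → S => x i) P = μ :=
    (measurePreserving_eval_infinitePi (fun _ : ℕ => μ) i).map_eq
  have hev (i : ℕ) : MeasurePreserving (fun x : ℕ → S => x i) P μ :=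
    ⟨measurable_pi_apply i, hlaw i⟩
  have hmean : ∫ x, f (x 0) ∂P = ∫ s, f s ∂μ := by
    rw [← (hev 0).map_eq, integral_map (hev 0).measurable.aemeasurable
      (hf.aestronglyMeasurable)]
  have hslln := strong_law_Lp (μ := P) (p := 1) le_rfl ENNReal.one_ne_top
    (fun i x => f (x i))
    (memLp_one_iff_integrable.2 ((hev 0).integrable_comp_of_integrable hfi))
    (fun i j hij => (iIndepFun_infinitePi (P := fun _ : ℕ => μ) (X := fun _ => f)
      fun _ => hf).indepFun hij)
    (fun i => by
      have h1 : IdentDistrib (fun x : ℕ → S => x i) (fun x => x 0) P P :=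
        ⟨(hev i).measurable.aemeasurable, (hev 0).measurable.aemeasurable, by
          rw [hlaw, hlaw]⟩
      exact h1.comp hf)
  refine hslln.congr fun k => ?_
  have hmap : Measure.map (fun (x : ℕ → S) (b : Fin k) => x b) P =
      Measure.pi fun _ : Fin k => μ := by
    rw [hP, Measure.map_infinitePi_infinitePi_of_inj Fin.val_injective, Measure.infinitePi_eq_pi]
  rw [eLpNorm_one_eq_lintegral_enorm, hmean, ← hmap,
    lintegral_map (by fun_prop) (by fun_prop)]
  simp [Finset.sum_range]

variable {X₁ X₂ E : Type*} [MeasurableSpace X₁] [MeasurableSpace X₂] [MeasurableSpace E]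
  {p₁ : Measure X₁} {p₂ : Measure X₂} {ν : Measure E} [IsProbabilityMeasure p₁]
  [IsProbabilityMeasure p₂] [IsProbabilityMeasure ν]

theorem measurePreserving_zip (κ : Type*) [Fintype κ] :
    MeasurePreserving (fun (q : (κ → X₁) × (κ → X₂)) b => (q.1 b, q.2 b))
      ((Measure.pi fun _ => p₁).prod (Measure.pi fun _ => p₂))
      (Measure.pi fun _ => p₁.prod p₂) :=
  (measurePreserving_arrowProdEquivProdArrow X₁ X₂ κ (fun _ => p₁) fun _ => p₂).symm

/-- Injectivity makes the blocks use disjoint coordinates. Surjectivity is not needed: coordinates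
outside the range, such as the times after the last full block, are integrated out. -/
theorem measurePreserving_blocks {k η n : ℕ} {g : Fin k × Fin η → Fin n}
    (hg : Function.Injective g) :
    MeasurePreserving (fun (z : Fin n → E) b i => z (g (b, i))) (Measure.pi fun _ => ν)
      (Measure.pi fun _ => Measure.pi fun _ => ν) := by
  refine ⟨by fun_prop, ?_⟩
  have h1 := Measure.map_infinitePi_infinitePi_of_inj (P := fun _ : Fin n => ν) hg
  have h2 := Measure.infinitePi_map_curry (fun (_ : Fin k) (_ : Fin η) => ν)
  rw [← h1, Measure.map_map (MeasurableEquiv.measurable _) (by fun_prop)] at h2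
  simp only [Measure.infinitePi_eq_pi] at h2
  exact h2

theorem measurePreserving_zip_blocks {k η n : ℕ} {g : Fin k × Fin η → Fin n}
    (hg : Function.Injective g) :
    MeasurePreserving (fun (q : (Fin k → X₁) × (Fin k → X₂) × (Fin n → E)) b =>
        (q.1 b, q.2.1 b, fun i => q.2.2 (g (b, i))))
      ((Measure.pi fun _ => p₁).prod ((Measure.pi fun _ => p₂).prod (Measure.pi fun _ => ν)))
      (Measure.pi fun _ => p₁.prod (p₂.prod (Measure.pi fun _ => ν))) := by
  have h1 := ((MeasurePreserving.id (Measure.pi fun _ : Fin k => p₂)).prod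
    (measurePreserving_blocks (ν := ν) hg))
  have h2 := (measurePreserving_zip (p₁ := p₂) (p₂ := Measure.pi fun _ : Fin η => ν) (Fin k)).comp h1
  have h3 := (MeasurePreserving.id (Measure.pi fun _ : Fin k => p₁)).prod h2
  exact (measurePreserving_zip (Fin k)).comp h3

theorem lintegral_zip {k : ℕ} {φ : (Fin k → X₁ × X₂) → ℝ≥0∞} (hφ : Measurable φ) :
    ∫⁻ x₁, ∫⁻ x₂, φ (fun b => (x₁ b, x₂ b)) ∂(Measure.pi fun _ => p₂) ∂(Measure.pi fun _ => p₁) =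
      ∫⁻ q, φ q ∂(Measure.pi fun _ => p₁.prod p₂) := by
  rw [← (measurePreserving_zip (Fin k)).lintegral_comp hφ, lintegral_prod _ (by fun_prop)]

/-- Passes from the one-shot picture (whole codewords, then all the noise) to independent
identically distributed triples, one per block, to which the law of large numbers applies. -/
theorem lintegral_zip_blocks {k η n : ℕ} {g : Fin k × Fin η → Fin n} (hg : Function.Injective g)
    {φ : (Fin k → X₁ × X₂ × (Fin η → E)) → ℝ≥0∞} (hφ : Measurable φ) :
    ∫⁻ x₁, ∫⁻ x₂, ∫⁻ z, φ (fun b => (x₁ b, x₂ b, fun i => z (g (b, i))))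
        ∂(Measure.pi fun _ => ν) ∂(Measure.pi fun _ => p₂) ∂(Measure.pi fun _ => p₁) =
      ∫⁻ q, φ q ∂(Measure.pi fun _ => p₁.prod (p₂.prod (Measure.pi fun _ => ν))) := by
  rw [← (measurePreserving_zip_blocks hg).lintegral_comp hφ, lintegral_prod _ (by fun_prop)]
  refine lintegral_congr fun x₁ => ?_
  rw [lintegral_prod _ (by fun_prop)]

theorem lintegral_pi_prod {κ S : Type*} [Fintype κ] [MeasurableSpace S] (μ : Measure S)
    [IsProbabilityMeasure μ] {f : κ → S → ℝ≥0∞} (hf : ∀ b, Measurable (f b)) :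
    ∫⁻ x, ∏ b, f b (x b) ∂(Measure.pi fun _ : κ => μ) = ∏ b, ∫⁻ s, f b s ∂μ := by
  refine (lintegral_prod_eq_prod_lintegral_of_indepFun Finset.univ
    (fun b (x : κ → S) => f b (x b)) (iIndepFun_pi fun b => (hf b).aemeasurable) fun b => by fun_prop).trans ?_
  exact Finset.prod_congr rfl fun b _ => lintegral_pi_eval μ b (hf b)

end ProductMeasures

/-! ### Calculus of centred families with a given covariance matrix -/

section SecondMoments

/-- The random variables `ξ i` are centred and square-integrable, with covariance matrix `Γ`. -/
structure HasSecondMoments {Ω ι : Type*} [MeasurableSpace Ω] (μ : Measure Ω) (ξ : ι → Ω → ℝ)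
    (Γ : Matrix ι ι ℝ) : Prop where
  memLp : ∀ i, MemLp (ξ i) 2 μ
  mean : ∀ i, ∫ ω, ξ i ω ∂μ = 0
  cov : ∀ i j, ∫ ω, ξ i ω * ξ j ω ∂μ = Γ i j

namespace HasSecondMoments

variable {Ω Ω' ι κ : Type*} [MeasurableSpace Ω] [MeasurableSpace Ω'] {μ : Measure Ω}
  {μ' : Measure Ω'} {ξ : ι → Ω → ℝ} {Γ : Matrix ι ι ℝ} {ξ' : κ → Ω' → ℝ} {Γ' : Matrix κ κ ℝ}

theorem integrable [IsFiniteMeasure μ] (h : HasSecondMoments μ ξ Γ) (i : ι) :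
    Integrable (ξ i) μ :=
  (h.memLp i).integrable one_le_two

theorem integrable_mul (h : HasSecondMoments μ ξ Γ) (i j : ι) :
    Integrable (fun ω => ξ i ω * ξ j ω) μ :=
  (h.memLp i).integrable_mul (h.memLp j)

theorem reindex (h : HasSecondMoments μ ξ Γ) (f : κ → ι) :
    HasSecondMoments μ (fun a => ξ (f a)) (Γ.submatrix f f) :=
  ⟨fun _ => h.memLp _, fun _ => h.mean _, fun _ _ => h.cov _ _⟩

theorem linear [IsFiniteMeasure μ] [Fintype ι] (h : HasSecondMoments μ ξ Γ) (T : Matrix κ ι ℝ) :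
    HasSecondMoments μ (fun a ω => ∑ i, T a i * ξ i ω) (T * Γ * Tᵀ) where
  memLp a := memLp_finsetSum _ fun i _ => (h.memLp i).const_mul _
  mean a := by
    rw [integral_finsetSum _ fun i _ => (h.integrable i).const_mul _]
    simp [integral_const_mul, h.mean]
  cov a b := by
    have h1 (ω : Ω) : (∑ i, T a i * ξ i ω) * (∑ j, T b j * ξ j ω) =
        ∑ j, ∑ i, T a i * T b j * (ξ i ω * ξ j ω) := by
      rw [Finset.sum_mul_sum, Finset.sum_comm]
      exact Finset.sum_congr rfl fun _ _ => Finset.sum_congr rfl fun _ _ => by ring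
    simp_rw [h1]
    rw [integral_finsetSum _ fun j _ => integrable_finsetSum _ fun i _ =>
      (h.integrable_mul i j).const_mul _]
    simp_rw [integral_finsetSum _ fun i _ => (h.integrable_mul i _).const_mul _,
      integral_const_mul, h.cov, Matrix.mul_apply, Finset.sum_mul, Matrix.transpose_apply]
    exact Finset.sum_congr rfl fun _ _ => Finset.sum_congr rfl fun _ _ => by ring

theorem prod [IsProbabilityMeasure μ] [IsProbabilityMeasure μ'] (h : HasSecondMoments μ ξ Γ)
    (h' : HasSecondMoments μ' ξ' Γ') :
    HasSecondMoments (μ.prod μ')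
      (Sum.elim (fun i ω => ξ i ω.1) (fun j ω => ξ' j ω.2) : ι ⊕ κ → Ω × Ω' → ℝ)
      (Matrix.fromBlocks Γ 0 0 Γ') where
  memLp := by
    rintro (i | j)
    · exact (h.memLp i).comp_measurePreserving measurePreserving_fst
    · exact (h'.memLp j).comp_measurePreserving measurePreserving_snd
  mean := by
    rintro (i | j)
    · simpa [integral_fun_fst] using h.mean i
    · simpa [integral_fun_snd] using h'.mean j
  cov := by
    rintro (i | i) (j | j)
    · simpa using (integral_fun_fst (ν := μ') fun ω => ξ i ω * ξ j ω).trans (by simp [h.cov])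
    · simpa [h.mean] using integral_prod_mul (μ := μ) (ν := μ') (ξ i) (ξ' j)
    · simpa [h.mean, mul_comm] using integral_prod_mul (μ := μ) (ν := μ') (ξ j) (ξ' i)
    · simpa using (integral_fun_snd (μ := μ) fun ω => ξ' i ω * ξ' j ω).trans (by simp [h'.cov])

theorem pi {τ : Type*} [Fintype τ] [DecidableEq τ] [IsProbabilityMeasure μ]
    (h : HasSecondMoments μ ξ Γ) :
    HasSecondMoments (Measure.pi fun _ : τ => μ) (fun (q : ι × τ) ω => ξ q.1 (ω q.2))
      (Γ ⊗ₖ (1 : Matrix τ τ ℝ)) where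
  memLp q := (h.memLp q.1).comp_measurePreserving (measurePreserving_eval (fun _ : τ => μ) q.2)
  mean q := (integral_comp_eval (μ := fun _ : τ => μ) (i := q.2)
    (h.memLp q.1).aestronglyMeasurable).trans (h.mean q.1)
  cov := by
    rintro ⟨i, s⟩ ⟨j, t⟩
    by_cases hst : s = t
    · subst hst
      rw [Matrix.kroneckerMap_apply, Matrix.one_apply_eq, mul_one, ← h.cov]
      exact integral_comp_eval (μ := fun _ : τ => μ) (i := s)
        (h.integrable_mul i j).aestronglyMeasurable
    · rw [Matrix.kroneckerMap_apply, Matrix.one_apply_ne hst, mul_zero]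
      have hm (i : ι) (s : τ) : AEStronglyMeasurable (fun ω : τ → Ω => ξ i (ω s))
          (Measure.pi fun _ : τ => μ) :=
        ((h.memLp i).comp_measurePreserving
          (measurePreserving_eval (fun _ : τ => μ) s)).aestronglyMeasurable
      have hind : IndepFun (fun ω : τ → Ω => ξ i (ω s)) (fun ω => ξ j (ω t))
          (Measure.pi fun _ : τ => μ) := by
        have h1 : IndepFun (fun ω : τ → Ω => ω s) (fun ω => ω t) (Measure.pi fun _ : τ => μ) :=
          (iIndepFun_pi (μ := fun _ : τ => μ) (X := fun _ x => x)
            fun _ => measurable_id.aemeasurable).indepFun hst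
        refine h1.comp₀ (measurable_pi_apply s).aemeasurable (measurable_pi_apply t).aemeasurable
          ?_ ?_
        · rw [(measurePreserving_eval (fun _ : τ => μ) s).map_eq]
          exact (h.memLp i).aestronglyMeasurable.aemeasurable
        · rw [(measurePreserving_eval (fun _ : τ => μ) t).map_eq]
          exact (h.memLp j).aestronglyMeasurable.aemeasurable
      refine (hind.integral_fun_mul_eq_mul_integral (hm i s) (hm j t)).trans ?_
      rw [integral_comp_eval (μ := fun _ : τ => μ) (i := s) (h.memLp i).aestronglyMeasurable, h.mean,
        zero_mul]

theorem integrable_affine_sq [IsFiniteMeasure μ] (h : HasSecondMoments μ ξ Γ) (d : ℝ) (i : ι) :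
    Integrable (fun ω => (d + ξ i ω) ^ 2) μ :=
  ((memLp_const d).add (h.memLp i)).integrable_sq

theorem integral_affine_sq [IsProbabilityMeasure μ] (h : HasSecondMoments μ ξ Γ) (d : ℝ) (i : ι) :
    ∫ ω, (d + ξ i ω) ^ 2 ∂μ = d ^ 2 + Γ i i := by
  have h1 (ω : Ω) : (d + ξ i ω) ^ 2 = d ^ 2 + (2 * d * ξ i ω + ξ i ω * ξ i ω) := by ring
  have h2 : Integrable (fun ω => 2 * d * ξ i ω + ξ i ω * ξ i ω) μ :=
    ((h.integrable i).const_mul _).add (h.integrable_mul i i)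
  simp_rw [h1]
  rw [integral_add (integrable_const _) h2, integral_add ((h.integrable i).const_mul _)
    (h.integrable_mul i i), integral_const_mul, h.mean,
    h.cov]
  simp

end HasSecondMoments

theorem hasSecondMoments_gaussianReal (s : ℝ) (hs : 0 ≤ s) :
    HasSecondMoments (gaussianReal 0 s.toNNReal) (fun (_ : Unit) x => x)
      (Matrix.of fun _ _ => s) where
  memLp _ := memLp_id_gaussianReal 2
  mean _ := integral_id_gaussianReal
  cov _ _ := by
    have := variance_id_gaussianReal (μ := 0) (v := s.toNNReal)
    rw [variance_eq_integral (by fun_prop)] at this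
    simpa [hs, sq] using this

theorem hasSecondMoments_multivariateGaussian {ι : Type*} [Fintype ι] [DecidableEq ι]
    {S : Matrix ι ι ℝ} (hS : S.PosSemidef) :
    HasSecondMoments (multivariateGaussian 0 S) (fun i (x : EuclideanSpace ℝ ι) => x i) S := by
  have hm (i : ι) : MemLp (fun x : EuclideanSpace ℝ ι => x i) 2 (multivariateGaussian 0 S) :=
    (EuclideanSpace.proj (𝕜 := ℝ) i).comp_memLp' IsGaussian.memLp_two_id
  have h0 (i : ι) : ∫ x : EuclideanSpace ℝ ι, x i ∂(multivariateGaussian 0 S) = 0 := by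
    have := (EuclideanSpace.proj (𝕜 := ℝ) i).integral_comp_comm
      (IsGaussian.integrable_id (μ := multivariateGaussian (0 : EuclideanSpace ℝ ι) S))
    simpa using this
  refine ⟨hm, h0, fun i j => ?_⟩
  rw [← covariance_eval_multivariateGaussian (μ := 0) hS, covariance_eq_sub (hm i) (hm j), h0, h0]
  simp

end SecondMoments

/-! ### Gaussian information densities -/

section InformationDensity

/-- The logarithm of the ratio of the densities at `x` of the Gaussian laws of mean `u` and variance
`e`, and of mean `0` and variance `s`. -/
noncomputable def infoDensity (s e u x : ℝ) : ℝ :=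
  1 / 2 * Real.log (s / e) - (x - u) ^ 2 / (2 * e) + x ^ 2 / (2 * s)

/-- Multiplying the ratio by the prior density leaves the Gaussian density of mean `u`. As `u` is
arbitrary, it may be any estimate computed from the output, which gives the bound for every fixed
output. -/
theorem lintegral_exp_infoDensity {s e : ℝ} (hs : 0 < s) (he : 0 < e) (u : ℝ) :
    ∫⁻ x, ENNReal.ofReal (Real.exp (infoDensity s e u x)) ∂(gaussianReal 0 s.toNNReal) = 1 := by
  have hs' : s.toNNReal ≠ 0 := by simpa using hs
  have he' : e.toNNReal ≠ 0 := by simpa using he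
  have hm : Measurable fun x => ENNReal.ofReal (Real.exp (infoDensity s e u x)) := by
    unfold infoDensity; fun_prop
  rw [gaussianReal_of_var_ne_zero _ hs', lintegral_withDensity_eq_lintegral_mul _ (by fun_prop) hm,
    ← lintegral_gaussianPDF_eq_one u he']
  refine lintegral_congr fun x => ?_
  rw [Pi.mul_apply, gaussianPDF, gaussianPDF, ← ENNReal.ofReal_mul (gaussianPDFReal_nonneg _ _ _)]
  congr 1
  have hsqrt : Real.exp (1 / 2 * Real.log (s / e)) =
      √(2 * Real.pi * s) * (√(2 * Real.pi * e))⁻¹ := by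
    rw [← Real.sqrt_inv, ← Real.sqrt_mul (by positivity), one_div_mul_eq_div, Real.exp_half,
      Real.exp_log (by positivity)]
    congr 1
    field_simp
  have hpos : √(2 * Real.pi * s) ≠ 0 := by positivity
  rw [gaussianPDFReal, gaussianPDFReal, infoDensity, Real.coe_toNNReal _ hs.le,
    Real.coe_toNNReal _ he.le, Real.exp_add, Real.exp_sub, hsqrt, sub_zero, neg_div, neg_div,
    Real.exp_neg, Real.exp_neg]
  field_simp

theorem integrable_infoDensity {Ω : Type*} [MeasurableSpace Ω] {μ : Measure Ω}
    [IsFiniteMeasure μ] {X u : Ω → ℝ} (s e : ℝ) (hX : Integrable (fun ω => X ω ^ 2) μ)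
    (hR : Integrable (fun ω => (X ω - u ω) ^ 2) μ) :
    Integrable (fun ω => infoDensity s e (u ω) (X ω)) μ :=
  ((integrable_const _).sub (hR.div_const _)).add (hX.div_const _)

/-- With matching second moments the two quadratic terms have means `-1/2` and `1/2` and cancel. No
Gaussianity of `X` or `u` enters. -/
theorem integral_infoDensity {Ω : Type*} [MeasurableSpace Ω] {μ : Measure Ω}
    [IsProbabilityMeasure μ] {X u : Ω → ℝ} {s e : ℝ} (hs : 0 < s) (he : 0 < e)
    (hX : Integrable (fun ω => X ω ^ 2) μ) (hXs : ∫ ω, X ω ^ 2 ∂μ = s)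
    (hR : Integrable (fun ω => (X ω - u ω) ^ 2) μ) (hRe : ∫ ω, (X ω - u ω) ^ 2 ∂μ = e) :
    ∫ ω, infoDensity s e (u ω) (X ω) ∂μ = 1 / 2 * Real.log (s / e) := by
  have h1 : Integrable (fun ω => 1 / 2 * Real.log (s / e) - (X ω - u ω) ^ 2 / (2 * e)) μ :=
    (integrable_const _).sub (hR.div_const _)
  unfold infoDensity
  rw [integral_add h1 (hX.div_const _), integral_sub (integrable_const _) (hR.div_const _),
    integral_div, integral_div, hXs, hRe, integral_const]
  simp only [probReal_univ, one_smul]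
  field_simp
  ring

end InformationDensity

/-! ### Linear estimation error as a ratio of determinants -/

section LinearEstimation

variable {m : Type*} [Fintype m] [DecidableEq m] {η : ℕ}

/-- The linear minimum-mean-square-error estimate of `x` from `C (x a + U)`, where `x` has variance
`s` and `U` has covariance matrix `Γ`. -/
theorem exists_linear_estimator {C : Matrix m (Fin η) ℝ} {Γ : Matrix (Fin η) (Fin η) ℝ}
    (hS : (C * Γ * Cᵀ).PosDef) {s : ℝ} (hs : 0 < s) (a : Fin η → ℝ) :
    0 < (C * (s • Matrix.vecMulVec a a + Γ) * Cᵀ).det ∧ ∃ k : Fin η → ℝ,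
      (1 - k ⬝ᵥ a) ^ 2 * s + k ⬝ᵥ Γ *ᵥ k =
        s / ((C * (s • Matrix.vecMulVec a a + Γ) * Cᵀ).det / (C * Γ * Cᵀ).det) := by
  set S := C * Γ * Cᵀ with hSdef
  set b := C *ᵥ a with hb
  set v := S⁻¹ *ᵥ b with hv
  have hdet : IsUnit S.det := (Matrix.isUnit_iff_isUnit_det _).1 hS.isUnit
  have hSv : S *ᵥ v = b := by
    rw [hv, Matrix.mulVec_mulVec, Matrix.mul_nonsing_inv _ hdet, Matrix.one_mulVec]
  set β := v ⬝ᵥ b with hβ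
  have hβ0 : 0 ≤ β := by
    have := hS.posSemidef.dotProduct_mulVec_nonneg v
    rwa [hSv, star_trivial] at this
  have hden : 0 < 1 + s * β := by positivity
  have hmat : C * (s • Matrix.vecMulVec a a + Γ) * Cᵀ =
      S + Matrix.replicateCol Unit (s • b) * Matrix.replicateRow Unit b := by
    rw [← Matrix.vecMulVec_eq, Matrix.mul_add, Matrix.add_mul, Matrix.mul_smul, Matrix.smul_mul,
      Matrix.mul_vecMulVec, Matrix.vecMulVec_mul, Matrix.smul_vecMulVec, Matrix.vecMul_transpose,
      add_comm]
  -- The signal is a rank-one perturbation of `S`, so the matrix determinant lemma applies.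
  have hdet2 : (C * (s • Matrix.vecMulVec a a + Γ) * Cᵀ).det = S.det * (1 + s * β) := by
    rw [hmat, Matrix.det_add_replicateCol_mul_replicateRow hdet, Matrix.det_unique (n := Unit)]
    congr 1
    rw [Matrix.add_apply, Matrix.one_apply_eq, Matrix.mul_assoc, ← Matrix.replicateCol_mulVec,
      Matrix.mulVec_smul, ← hv]
    simp [Matrix.mul_apply, hβ, dotProduct, Finset.mul_sum, mul_comm, mul_left_comm]
  -- By the Sherman–Morrison formula, `s (s b bᵀ + S)⁻¹ b = (s / (1 + s β)) S⁻¹ b`; composing with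
  -- `C` gives the coefficients of the optimal estimate.
  refine ⟨hdet2 ▸ mul_pos hS.det_pos hden, (s / (1 + s * β)) • (v ᵥ* C), ?_⟩
  have hk1 : (v ᵥ* C) ⬝ᵥ a = β := by rw [← Matrix.dotProduct_mulVec]
  have hk2 : (v ᵥ* C) ⬝ᵥ Γ *ᵥ (v ᵥ* C) = β := by
    rw [← Matrix.mulVec_transpose C v, Matrix.mulVec_transpose, ← Matrix.dotProduct_mulVec,
      ← Matrix.mulVec_transpose C v, Matrix.mulVec_mulVec, Matrix.mulVec_mulVec,
      ← hSdef, hSv]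
  rw [hdet2, mul_div_cancel_left₀ _ hS.det_pos.ne', Matrix.mulVec_smul, smul_dotProduct,
    smul_dotProduct, dotProduct_smul, hk1, hk2]
  simp only [smul_eq_mul]
  field_simp
  ring

end LinearEstimation

/-! ### Information densities of one block -/

section PerLetter

variable {η : ℕ} {E : Type*} [MeasurableSpace E] {μ : Measure E} [IsProbabilityMeasure μ]
  {U : E → Fin η → ℝ} {Γ : Matrix (Fin η) (Fin η) ℝ}

theorem secondMoment_linear_combination (hU : HasSecondMoments μ (fun i z => U z i) Γ) {s : ℝ}
    (hs : 0 ≤ s) (α β : ℝ) (k : Fin η → ℝ) :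
    Integrable (fun q : ℝ × ℝ × E => (α * q.1 + β * q.2.1 + k ⬝ᵥ U q.2.2) ^ 2)
      ((gaussianReal 0 s.toNNReal).prod ((gaussianReal 0 s.toNNReal).prod μ)) ∧
    ∫ q : ℝ × ℝ × E, (α * q.1 + β * q.2.1 + k ⬝ᵥ U q.2.2) ^ 2
      ∂((gaussianReal 0 s.toNNReal).prod ((gaussianReal 0 s.toNNReal).prod μ)) =
      α ^ 2 * s + β ^ 2 * s + k ⬝ᵥ Γ *ᵥ k := by
  have hg := hasSecondMoments_gaussianReal s hs
  have h := (hg.prod (hg.prod hU)).linear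
    (Matrix.of fun (_ : Unit) => Sum.elim (fun _ => α) (Sum.elim (fun _ => β) k))
  have h1 := h.integrable_affine_sq 0 ()
  have h2 := h.integral_affine_sq 0 ()
  have e1 (q : ℝ × ℝ × E) : α * q.1 + β * q.2.1 + k ⬝ᵥ U q.2.2 =
      0 + ∑ i, (Matrix.of fun (_ : Unit) => Sum.elim (fun _ => α) (Sum.elim (fun _ => β) k)) () i *
        (Sum.elim (fun (_ : Unit) ω => ω.1) (fun j ω => (Sum.elim (fun (_ : Unit) ω => ω.1)
          (fun j ω => U ω.2 j) : Unit ⊕ Fin η → ℝ × E → ℝ) j ω.2) :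
          Unit ⊕ Unit ⊕ Fin η → ℝ × ℝ × E → ℝ) i q := by
    simp [dotProduct, add_assoc]
  simp_rw [e1]
  refine ⟨h1, h2.trans ?_⟩
  simp only [Matrix.mul_apply, Matrix.transpose_apply, Matrix.of_apply, Fintype.sum_sum_type,
    Sum.elim_inl, Sum.elim_inr, Finset.univ_unique, Finset.sum_singleton, Matrix.fromBlocks_apply₁₁,
    Matrix.fromBlocks_apply₁₂, Matrix.fromBlocks_apply₂₁, Matrix.fromBlocks_apply₂₂,
    Matrix.zero_apply, mul_zero, add_zero, zero_add, Finset.sum_const_zero,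
    Matrix.mulVec, dotProduct, Finset.sum_mul, Finset.mul_sum]
  rw [Finset.sum_comm (f := fun i j => k i * (Γ i j * k j)), add_assoc]
  simp only [mul_assoc]
  ring_nf

/-- Per-letter information densities of the vector multiple-access channel with Gaussian inputs of
variance `s` and channel output `x₁ a₁ + x₂ a₂ + U`, of which the receiver only uses the product
with `C`. -/
theorem exists_infoDensities {m : Type*} [Fintype m] [DecidableEq m]
    (hU : HasSecondMoments μ (fun i z => U z i) Γ) {s : ℝ} (hs : 0 < s) (a₁ a₂ : Fin η → ℝ)
    {C : Matrix m (Fin η) ℝ} (hS : (C * Γ * Cᵀ).PosDef) :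
    ∃ i₁ i₂ i₁₂ : ℝ × ℝ × (Fin η → ℝ) → ℝ, (Measurable i₁ ∧ Measurable i₂ ∧ Measurable i₁₂) ∧
      ((∀ x₂ y, ∫⁻ x, ENNReal.ofReal (Real.exp (i₁ (x, x₂, y))) ∂(gaussianReal 0 s.toNNReal) ≤ 1) ∧
      (∀ x₁ y, ∫⁻ x, ENNReal.ofReal (Real.exp (i₂ (x₁, x, y))) ∂(gaussianReal 0 s.toNNReal) ≤ 1) ∧
      (∀ y, ∫⁻ x₁, ∫⁻ x₂, ENNReal.ofReal (Real.exp (i₁₂ (x₁, x₂, y)))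
        ∂(gaussianReal 0 s.toNNReal) ∂(gaussianReal 0 s.toNNReal) ≤ 1)) ∧
      ∀ f ∈ [(i₁, Matrix.vecMulVec a₁ a₁), (i₂, Matrix.vecMulVec a₂ a₂),
          (i₁₂, Matrix.vecMulVec a₁ a₁ + Matrix.vecMulVec a₂ a₂)],
        Integrable (fun q : ℝ × ℝ × E => f.1 (q.1, q.2.1, q.1 • a₁ + q.2.1 • a₂ + U q.2.2))
          ((gaussianReal 0 s.toNNReal).prod ((gaussianReal 0 s.toNNReal).prod μ)) ∧
        ∫ q : ℝ × ℝ × E, f.1 (q.1, q.2.1, q.1 • a₁ + q.2.1 • a₂ + U q.2.2)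
          ∂((gaussianReal 0 s.toNNReal).prod ((gaussianReal 0 s.toNNReal).prod μ)) =
        1 / 2 * Real.log ((C * (s • f.2 + Γ) * Cᵀ).det / (C * Γ * Cᵀ).det) := by
  set P := (gaussianReal 0 s.toNNReal).prod ((gaussianReal 0 s.toNNReal).prod μ) with hP
  -- The effective noise seen by user 1 when user 2 is not yet decoded.
  have hS' : (C * (s • Matrix.vecMulVec a₂ a₂ + Γ) * Cᵀ).PosDef := by
    rw [Matrix.mul_add, Matrix.add_mul, add_comm]
    refine hS.add_posSemidef ?_
    have := ((Matrix.posSemidef_vecMulVec_self_star a₂).smul hs.le).mul_mul_conjTranspose_same C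
    simpa using this
  obtain ⟨hd1, k₁, hk₁⟩ := exists_linear_estimator hS hs a₁
  obtain ⟨hd2, k₂, hk₂⟩ := exists_linear_estimator hS hs a₂
  obtain ⟨hd3, k₃, hk₃⟩ := exists_linear_estimator hS' hs a₁
  set ρ₁ := (C * (s • Matrix.vecMulVec a₁ a₁ + Γ) * Cᵀ).det / (C * Γ * Cᵀ).det with hρ₁
  set ρ₂ := (C * (s • Matrix.vecMulVec a₂ a₂ + Γ) * Cᵀ).det / (C * Γ * Cᵀ).det with hρ₂
  set ρ₃ := (C * (s • Matrix.vecMulVec a₁ a₁ + (s • Matrix.vecMulVec a₂ a₂ + Γ)) * Cᵀ).det /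
    (C * (s • Matrix.vecMulVec a₂ a₂ + Γ) * Cᵀ).det with hρ₃
  have hp1 : 0 < ρ₁ := div_pos hd1 hS.det_pos
  have hp2 : 0 < ρ₂ := div_pos hd2 hS.det_pos
  have hp3 : 0 < ρ₃ := div_pos hd3 hS'.det_pos
  clear_value ρ₁ ρ₂ ρ₃
  have hX₁ := secondMoment_linear_combination hU hs.le 1 0 0
  have hX₂ := secondMoment_linear_combination hU hs.le 0 1 0
  have hR₁ := secondMoment_linear_combination hU hs.le (1 - k₁ ⬝ᵥ a₁) 0 (-k₁)
  have hR₂ := secondMoment_linear_combination hU hs.le 0 (1 - k₂ ⬝ᵥ a₂) (-k₂)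
  have hR₃ := secondMoment_linear_combination hU hs.le (1 - k₃ ⬝ᵥ a₁) (-(k₃ ⬝ᵥ a₂)) (-k₃)
  rw [← hP] at hX₁ hX₂ hR₁ hR₂ hR₃
  have hPprob : IsProbabilityMeasure P := by rw [hP]; infer_instance
  clear_value P
  have e1 (q : ℝ × ℝ × E) : (1 - k₁ ⬝ᵥ a₁) * q.1 + -k₁ ⬝ᵥ U q.2.2 =
      q.1 - k₁ ⬝ᵥ (q.1 • a₁ + q.2.1 • a₂ + U q.2.2 - q.2.1 • a₂) := by
    simp only [dotProduct_add, dotProduct_sub, dotProduct_smul, neg_dotProduct, smul_eq_mul]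
    ring
  have e2 (q : ℝ × ℝ × E) : (1 - k₂ ⬝ᵥ a₂) * q.2.1 + -k₂ ⬝ᵥ U q.2.2 =
      q.2.1 - k₂ ⬝ᵥ (q.1 • a₁ + q.2.1 • a₂ + U q.2.2 - q.1 • a₁) := by
    simp only [dotProduct_add, dotProduct_sub, dotProduct_smul, neg_dotProduct, smul_eq_mul]
    ring
  have e3 (q : ℝ × ℝ × E) : (1 - k₃ ⬝ᵥ a₁) * q.1 + -(k₃ ⬝ᵥ a₂) * q.2.1 + -k₃ ⬝ᵥ U q.2.2 =
      q.1 - k₃ ⬝ᵥ (q.1 • a₁ + q.2.1 • a₂ + U q.2.2) := by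
    simp only [dotProduct_add, dotProduct_smul, neg_dotProduct, smul_eq_mul]
    ring
  have ev₁ : (1 - k₁ ⬝ᵥ a₁) ^ 2 * s + 0 ^ 2 * s + -k₁ ⬝ᵥ Γ *ᵥ -k₁ = s / ρ₁ := by
    rw [← hk₁, Matrix.mulVec_neg, neg_dotProduct_neg]; ring
  have ev₂ : 0 ^ 2 * s + (1 - k₂ ⬝ᵥ a₂) ^ 2 * s + -k₂ ⬝ᵥ Γ *ᵥ -k₂ = s / ρ₂ := by
    rw [← hk₂, Matrix.mulVec_neg, neg_dotProduct_neg]; ring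
  have ev₃ : (1 - k₃ ⬝ᵥ a₁) ^ 2 * s + (-(k₃ ⬝ᵥ a₂)) ^ 2 * s + -k₃ ⬝ᵥ Γ *ᵥ -k₃ = s / ρ₃ := by
    rw [← hk₃, Matrix.mulVec_neg, neg_dotProduct_neg, Matrix.add_mulVec, dotProduct_add,
      Matrix.smul_mulVec, dotProduct_smul, Matrix.vecMulVec_mulVec]
    simp [dotProduct_comm a₂ k₃]
    ring
  rw [ev₁] at hR₁
  rw [ev₂] at hR₂
  rw [ev₃] at hR₃
  simp only [e1, e2, e3, one_mul, zero_mul, zero_dotProduct, add_zero, zero_add, one_pow, ne_eq,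
    OfNat.ofNat_ne_zero, not_false_eq_true, zero_pow] at hX₁ hX₂ hR₁ hR₂ hR₃
  have hlog (ρ : ℝ) (hρ : 0 < ρ) : s / (s / ρ) = ρ := by field_simp
  have he1 := div_pos hs hp1
  have he2 := div_pos hs hp2
  have he3 := div_pos hs hp3
  -- The first two densities subtract the known symbol of the other user before estimating. The
  -- third is a chain rule: `x₁` from the raw output, then `x₂` once `x₁` is known.
  refine ⟨fun q => infoDensity s (s / ρ₁) (k₁ ⬝ᵥ (q.2.2 - q.2.1 • a₂)) q.1,
    fun q => infoDensity s (s / ρ₂) (k₂ ⬝ᵥ (q.2.2 - q.1 • a₁)) q.2.1,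
    fun q => infoDensity s (s / ρ₃) (k₃ ⬝ᵥ q.2.2) q.1 +
      infoDensity s (s / ρ₂) (k₂ ⬝ᵥ (q.2.2 - q.1 • a₁)) q.2.1, ?_, ⟨?_, ?_, ?_⟩, ?_⟩
  · refine ⟨?_, ?_, ?_⟩ <;> unfold infoDensity dotProduct <;> fun_prop
  · exact fun x₂ y => (lintegral_exp_infoDensity hs he1 (k₁ ⬝ᵥ (y - x₂ • a₂))).le
  · exact fun x₁ y => (lintegral_exp_infoDensity hs he2 (k₂ ⬝ᵥ (y - x₁ • a₁))).le
  · intro y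
    simp_rw [Real.exp_add, ENNReal.ofReal_mul (Real.exp_nonneg _)]
    have hin (x₁ : ℝ) : ∫⁻ x₂, ENNReal.ofReal (Real.exp (infoDensity s (s / ρ₃) (k₃ ⬝ᵥ y) x₁)) *
        ENNReal.ofReal (Real.exp (infoDensity s (s / ρ₂) (k₂ ⬝ᵥ (y - x₁ • a₁)) x₂))
        ∂(gaussianReal 0 s.toNNReal) =
        ENNReal.ofReal (Real.exp (infoDensity s (s / ρ₃) (k₃ ⬝ᵥ y) x₁)) := by
      rw [lintegral_const_mul _ (by unfold infoDensity; fun_prop),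
        lintegral_exp_infoDensity hs he2, mul_one]
    simp_rw [hin]
    exact (lintegral_exp_infoDensity hs he3 _).le
  · have r1 := integrable_infoDensity s (s / ρ₁) hX₁.1 hR₁.1
    have r2 := integrable_infoDensity s (s / ρ₂) hX₂.1 hR₂.1
    have r3 := integrable_infoDensity s (s / ρ₃) hX₁.1 hR₃.1
    have t1 := integral_infoDensity hs he1 hX₁.1 hX₁.2 hR₁.1 hR₁.2
    have t2 := integral_infoDensity hs he2 hX₂.1 hX₂.2 hR₂.1 hR₂.2
    have t3 := integral_infoDensity hs he3 hX₁.1 hX₁.2 hR₃.1 hR₃.2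
    rw [hlog _ hp1] at t1
    rw [hlog _ hp2] at t2
    rw [hlog _ hp3] at t3
    simp only [List.forall_mem_cons, List.not_mem_nil, false_implies, implies_true, and_true]
    refine ⟨⟨r1, hρ₁ ▸ t1⟩, ⟨r2, hρ₂ ▸ t2⟩, r3.add r2, ?_⟩
    -- The determinant with user 2 alone cancels in `ρ₃ * ρ₂`.
    rw [integral_add r3 r2, t2, t3, ← mul_add, ← Real.log_mul hp3.ne' hp2.ne', smul_add, add_assoc,
      hρ₃, hρ₂, div_mul_div_cancel₀ hS'.det_pos.ne']

end PerLetter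

/-! ### Signal and noise inside one block, and their powers -/

section BlockNoise

variable {η : ℕ} {N : ℝ} {KW : Matrix (Fin 2) (Fin 2) ℝ}

instance isProbabilityMeasure_noiseLaw : IsProbabilityMeasure (noiseLaw N KW) := by
  unfold noiseLaw; infer_instance

theorem hasSecondMoments_noiseLaw (hN : 0 ≤ N) (hKW : KW.PosSemidef) :
    HasSecondMoments (noiseLaw N KW) (Sum.elim (fun _ z => z.1) fun ν z => z.2 ν :
      Unit ⊕ Fin 2 → ℝ × EuclideanSpace ℝ (Fin 2) → ℝ)
      (Matrix.fromBlocks (Matrix.of fun _ _ => N) 0 0 KW) :=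
  (hasSecondMoments_gaussianReal N hN).prod (hasSecondMoments_multivariateGaussian hKW)

/-- The covariance of linear functions of the noise in a block. -/
theorem hasSecondMoments_block {κ : Type*} (hN : 0 ≤ N) (hKW : KW.PosSemidef)
    (A₁ : Matrix κ (Fin η) ℝ) (A₂ : Matrix κ (Fin 2 × Fin η) ℝ) :
    HasSecondMoments (Measure.pi fun _ : Fin η => noiseLaw N KW)
      (fun p z => ((A₁ *ᵥ fun j => (z j).1) + A₂ *ᵥ fun q => (z q.2).2 q.1) p)
      (N • (A₁ * A₁ᵀ) + A₂ * (KW ⊗ₖ (1 : Matrix (Fin η) (Fin η) ℝ)) * A₂ᵀ) := by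
  have h := ((hasSecondMoments_noiseLaw hN hKW).pi (τ := Fin η)).linear
    (Matrix.of fun (p : κ) (q : (Unit ⊕ Fin 2) × Fin η) =>
      Sum.elim (fun _ => A₁ p q.2) (fun ν => A₂ p (ν, q.2)) q.1)
  convert h using 1
  · ext p z
    simp [Fintype.sum_prod_type, Fintype.sum_sum_type, Matrix.mulVec, dotProduct]
  · ext p p'
    simp only [Matrix.add_apply, Matrix.smul_apply, Matrix.mul_apply, Matrix.transpose_apply,
      Matrix.of_apply, Fintype.sum_prod_type, Fintype.sum_sum_type, Sum.elim_inl, Sum.elim_inr,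
      Finset.univ_unique, Finset.sum_singleton, Matrix.kroneckerMap_apply,
      Matrix.fromBlocks_apply₁₁, Matrix.fromBlocks_apply₁₂, Matrix.fromBlocks_apply₂₁,
      Matrix.fromBlocks_apply₂₂, Matrix.zero_apply, mul_zero, Finset.sum_const_zero,
      add_zero, zero_add, Matrix.one_apply, mul_ite, mul_one, Finset.mem_univ,
      if_true, Finset.sum_ite_eq', smul_eq_mul, Finset.mul_sum]
    congr 1
    exact Finset.sum_congr rfl fun _ _ => by ring

/-- The noise that remains when the receiver has removed the fed-back outputs from a block. -/
noncomputable def residualNoise (B₁ B₂ : Matrix (Fin η) (Fin η) ℝ)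
    (z : Fin η → ℝ × EuclideanSpace ℝ (Fin 2)) : Fin η → ℝ :=
  (fun i => (z i).1) + Bb B₁ B₂ *ᵥ fun q => (z q.2).2 q.1

theorem measurable_residualNoise (B₁ B₂ : Matrix (Fin η) (Fin η) ℝ) :
    Measurable (residualNoise B₁ B₂) := by
  unfold residualNoise Matrix.mulVec dotProduct
  fun_prop

theorem hasSecondMoments_residualNoise (hN : 0 ≤ N) (hKW : KW.PosSemidef)
    (B₁ B₂ : Matrix (Fin η) (Fin η) ℝ) :
    HasSecondMoments (Measure.pi fun _ : Fin η => noiseLaw N KW)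
      (fun i z => residualNoise B₁ B₂ z i) (noiseCov N KW B₁ B₂) := by
  have h := hasSecondMoments_block hN hKW (1 : Matrix (Fin η) (Fin η) ℝ) (Bb B₁ B₂)
  simpa [Matrix.one_mulVec, residualNoise, noiseCov] using h

/-- The contribution of the noise to the channel inputs in a block. -/
noncomputable def inputNoise (B₁ B₂ : Matrix (Fin η) (Fin η) ℝ)
    (z : Fin η → ℝ × EuclideanSpace ℝ (Fin 2)) : Fin 2 × Fin η → ℝ :=
  (1 - BB B₁ B₂)⁻¹ *ᵥ
    ((Bt B₁ B₂ *ᵥ fun j => (z j).1) + Bd B₁ B₂ *ᵥ fun q => (z q.2).2 q.1)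

/-- The contribution of the code symbols `x` to the channel inputs in a block. -/
noncomputable def inputSignal (a₁ a₂ : Fin η → ℝ) (B₁ B₂ : Matrix (Fin η) (Fin η) ℝ)
    (x : Fin 2 → ℝ) : Fin 2 × Fin η → ℝ :=
  ((1 - BB B₁ B₂)⁻¹ * Ad a₁ a₂) *ᵥ x

theorem hasSecondMoments_inputNoise (hN : 0 ≤ N) (hKW : KW.PosSemidef)
    (B₁ B₂ : Matrix (Fin η) (Fin η) ℝ) :
    HasSecondMoments (Measure.pi fun _ : Fin η => noiseLaw N KW)
      (fun p z => inputNoise B₁ B₂ z p) ((1 - BB B₁ B₂)⁻¹ *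
        (N • (Bt B₁ B₂ * (Bt B₁ B₂)ᵀ) +
          Bd B₁ B₂ * (KW ⊗ₖ (1 : Matrix (Fin η) (Fin η) ℝ)) * (Bd B₁ B₂)ᵀ) *
        ((1 - BB B₁ B₂)⁻¹)ᵀ) :=
  (hasSecondMoments_block hN hKW (Bt B₁ B₂) (Bd B₁ B₂)).linear (1 - BB B₁ B₂)⁻¹

theorem hasSecondMoments_inputSignal {s : ℝ} (hs : 0 ≤ s) (a₁ a₂ : Fin η → ℝ)
    (B₁ B₂ : Matrix (Fin η) (Fin η) ℝ) :
    HasSecondMoments ((gaussianReal 0 s.toNNReal).prod (gaussianReal 0 s.toNNReal))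
      (fun p x => inputSignal a₁ a₂ B₁ B₂ ![x.1, x.2] p)
      (s • ((1 - BB B₁ B₂)⁻¹ * (Ad a₁ a₂ * (Ad a₁ a₂)ᵀ) * ((1 - BB B₁ B₂)⁻¹)ᵀ)) := by
  have hg := hasSecondMoments_gaussianReal s hs
  have h := ((hg.prod hg).reindex (![Sum.inl (), Sum.inr ()] : Fin 2 → Unit ⊕ Unit)).linear
    ((1 - BB B₁ B₂)⁻¹ * Ad a₁ a₂)
  have hΓ : ((Matrix.fromBlocks (Matrix.of fun _ _ => s) 0 0 (Matrix.of fun _ _ => s) :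
      Matrix (Unit ⊕ Unit) (Unit ⊕ Unit) ℝ).submatrix ![Sum.inl (), Sum.inr ()]
      ![Sum.inl (), Sum.inr ()]) = s • (1 : Matrix (Fin 2) (Fin 2) ℝ) := by
    ext i j
    fin_cases i <;> fin_cases j <;> simp
  rw [hΓ] at h
  convert h using 1
  · ext p x
    simp [inputSignal, Matrix.mulVec, dotProduct, Fin.sum_univ_two]
  · simp [Matrix.mul_assoc, Matrix.transpose_mul]

/-- The average power that the code symbols contribute to the inputs of a transmitter in a block. -/
noncomputable def signalPower (a₁ a₂ : Fin η → ℝ) (B₁ B₂ : Matrix (Fin η) (Fin η) ℝ) (ν : Fin 2) :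
    ℝ :=
  (diagBlock ((1 - BB B₁ B₂)⁻¹ * (Ad a₁ a₂ * (Ad a₁ a₂)ᵀ) * ((1 - BB B₁ B₂)⁻¹)ᵀ) ν).trace

/-- The average power that the noise contributes to the inputs of a transmitter in a block. -/
noncomputable def noisePower (N : ℝ) (KW : Matrix (Fin 2) (Fin 2) ℝ)
    (B₁ B₂ : Matrix (Fin η) (Fin η) ℝ) (ν : Fin 2) : ℝ :=
  (diagBlock ((1 - BB B₁ B₂)⁻¹ * (N • (Bt B₁ B₂ * (Bt B₁ B₂)ᵀ) +
    Bd B₁ B₂ * (KW ⊗ₖ (1 : Matrix (Fin η) (Fin η) ℝ)) * (Bd B₁ B₂)ᵀ) *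
    ((1 - BB B₁ B₂)⁻¹)ᵀ) ν).trace

theorem trace_diagBlock_inputCov (a₁ a₂ : Fin η → ℝ) (B₁ B₂ : Matrix (Fin η) (Fin η) ℝ)
    (ν : Fin 2) : (diagBlock (inputCov N KW a₁ a₂ B₁ B₂) ν).trace =
      signalPower a₁ a₂ B₁ B₂ ν + noisePower N KW B₁ B₂ ν := by
  rw [signalPower, noisePower, inputCov, ← Matrix.trace_add, add_assoc, Matrix.mul_add,
    Matrix.add_mul]
  rfl

theorem signalPower_eq_sum_sq (a₁ a₂ : Fin η → ℝ) (B₁ B₂ : Matrix (Fin η) (Fin η) ℝ) (ν : Fin 2) :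
    signalPower a₁ a₂ B₁ B₂ ν = ∑ i : Fin η, ∑ μ, ((1 - BB B₁ B₂)⁻¹ * Ad a₁ a₂) (ν, i) μ ^ 2 := by
  rw [signalPower, Matrix.trace]
  refine Finset.sum_congr rfl fun i _ => ?_
  rw [Matrix.diag_apply, diagBlock, Matrix.submatrix_apply, ← Matrix.mul_assoc, Matrix.mul_assoc,
    ← Matrix.transpose_mul, Matrix.mul_apply]
  exact Finset.sum_congr rfl fun μ _ => (sq _).symm

/-- The power of the contribution of the code symbols to the inputs of a transmitter in a block. -/
noncomputable def signalEnergy (a₁ a₂ : Fin η → ℝ) (B₁ B₂ : Matrix (Fin η) (Fin η) ℝ) (ν : Fin 2)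
    (x : ℝ × ℝ) : ℝ :=
  ∑ i, inputSignal a₁ a₂ B₁ B₂ ![x.1, x.2] (ν, i) ^ 2

theorem measurable_signalEnergy (a₁ a₂ : Fin η → ℝ) (B₁ B₂ : Matrix (Fin η) (Fin η) ℝ)
    (ν : Fin 2) : Measurable (signalEnergy a₁ a₂ B₁ B₂ ν) := by
  unfold signalEnergy inputSignal Matrix.mulVec dotProduct
  simp only [Fin.sum_univ_two, Matrix.cons_val_zero, Matrix.cons_val_one]
  fun_prop

/-- A transmitter with zero signal power gains no slack from `s < 1`. Here the power is a sum of
squares of the signal coefficients, so all of them vanish and there is no deviation to absorb. -/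
theorem signalEnergy_eq_zero {a₁ a₂ : Fin η → ℝ} {B₁ B₂ : Matrix (Fin η) (Fin η) ℝ} {ν : Fin 2}
    (h : signalPower a₁ a₂ B₁ B₂ ν = 0) (x : ℝ × ℝ) : signalEnergy a₁ a₂ B₁ B₂ ν x = 0 := by
  rw [signalPower_eq_sum_sq, Finset.sum_eq_zero_iff_of_nonneg fun _ _ => Finset.sum_nonneg
    fun _ _ => sq_nonneg _] at h
  refine Finset.sum_eq_zero fun i hi => ?_
  have h1 := h i hi
  rw [Finset.sum_eq_zero_iff_of_nonneg fun _ _ => sq_nonneg _] at h1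
  have h2 (μ : Fin 2) : ((1 - BB B₁ B₂)⁻¹ * Ad a₁ a₂) (ν, i) μ = 0 :=
    pow_eq_zero_iff two_ne_zero |>.1 (h1 μ (Finset.mem_univ _))
  simp [inputSignal, Matrix.mulVec, dotProduct, h2]

theorem signalPower_nonneg (a₁ a₂ : Fin η → ℝ) (B₁ B₂ : Matrix (Fin η) (Fin η) ℝ) (ν : Fin 2) :
    0 ≤ signalPower a₁ a₂ B₁ B₂ ν := by
  rw [signalPower_eq_sum_sq]
  positivity

theorem integrable_signalEnergy {s : ℝ} (hs : 0 ≤ s) (a₁ a₂ : Fin η → ℝ)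
    (B₁ B₂ : Matrix (Fin η) (Fin η) ℝ) (ν : Fin 2) :
    Integrable (signalEnergy a₁ a₂ B₁ B₂ ν)
      ((gaussianReal 0 s.toNNReal).prod (gaussianReal 0 s.toNNReal)) := by
  have h := hasSecondMoments_inputSignal hs a₁ a₂ B₁ B₂
  exact integrable_finsetSum _ fun i _ => by simpa using h.integrable_affine_sq 0 (ν, i)

theorem integral_signalEnergy {s : ℝ} (hs : 0 ≤ s) (a₁ a₂ : Fin η → ℝ)
    (B₁ B₂ : Matrix (Fin η) (Fin η) ℝ) (ν : Fin 2) :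
    ∫ x, signalEnergy a₁ a₂ B₁ B₂ ν x
      ∂((gaussianReal 0 s.toNNReal).prod (gaussianReal 0 s.toNNReal)) =
      s * signalPower a₁ a₂ B₁ B₂ ν := by
  have h := hasSecondMoments_inputSignal hs a₁ a₂ B₁ B₂
  unfold signalEnergy
  rw [integral_finsetSum _ fun i _ => by simpa using h.integrable_affine_sq 0 (ν, i), signalPower,
    Matrix.trace, Finset.mul_sum]
  refine Finset.sum_congr rfl fun i _ => ?_
  simpa [diagBlock] using h.integral_affine_sq 0 (ν, i)

/-- `BB B₁ B₂` is not triangular in its block order, but it is causal: an entry at time `i` depends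
only on both users' entries at earlier times. Induction on time, for both users at once, shows that
the kernel is trivial. -/
theorem isUnit_one_sub_BB {B₁ B₂ : Matrix (Fin η) (Fin η) ℝ} (h₁ : StrictlyLower B₁)
    (h₂ : StrictlyLower B₂) : IsUnit (1 - BB B₁ B₂) := by
  rw [← Matrix.mulVec_injective_iff_isUnit]
  refine (injective_iff_map_eq_zero (Matrix.mulVecLin (1 - BB B₁ B₂))).2 fun x hx => ?_
  have hB (ν : Fin 2) : StrictlyLower (![B₁, B₂] ν) := by
    fin_cases ν
    · exact h₁
    · exact h₂
  have hx' (p : Fin 2 × Fin η) : x p = ∑ q, ![B₁, B₂] p.1 p.2 q.2 * x q := by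
    have := congrFun hx p
    simpa [Matrix.sub_mulVec, sub_eq_zero, Matrix.mulVec, dotProduct, BB] using this
  have hzero : ∀ (i : ℕ) (p : Fin 2 × Fin η), (p.2 : ℕ) = i → x p = 0 := by
    intro i
    induction i using Nat.strong_induction_on with
    | _ i ih =>
      rintro p rfl
      rw [hx']
      refine Finset.sum_eq_zero fun q _ => ?_
      rcases lt_or_ge q.2 p.2 with h | h
      · rw [ih q.2 h q rfl, mul_zero]
      · rw [hB p.1 p.2 q.2 h, zero_mul]
  exact funext fun p => hzero _ p rfl

theorem posDef_noiseCov (hN : 0 < N) (hKW : KW.PosSemidef) (B₁ B₂ : Matrix (Fin η) (Fin η) ℝ) :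
    (noiseCov N KW B₁ B₂).PosDef := by
  refine (Matrix.PosDef.one.smul hN).add_posSemidef ?_
  have h := (hKW.kronecker (Matrix.PosSemidef.one : (1 : Matrix (Fin η) (Fin η) ℝ).PosSemidef))
  simpa using h.mul_mul_conjTranspose_same (Bb B₁ B₂)

/-- Nonsingularity of `C * Cᵀ` makes the rows of `C` independent, and compression by such a `C`
preserves positive definiteness. -/
theorem posDef_mul_noiseCov_mul {m : Type*} [Fintype m] [DecidableEq m] (hN : 0 < N)
    (hKW : KW.PosSemidef) (B₁ B₂ : Matrix (Fin η) (Fin η) ℝ) {C : Matrix m (Fin η) ℝ}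
    (hC : IsUnit (C * Cᵀ)) : (C * noiseCov N KW B₁ B₂ * Cᵀ).PosDef := by
  have hinj : Function.Injective C.vecMul := by
    have h := Matrix.vecMul_injective_iff_isUnit.2 hC
    intro x y hxy
    apply h
    simp only [← Matrix.vecMul_vecMul]
    exact congrArg (fun u => u ᵥ* Cᵀ) hxy
  simpa using (posDef_noiseCov hN hKW B₁ B₂).mul_mul_conjTranspose_same hinj

end BlockNoise

/-! ### The blockwise linear feedback code and its input-output relations -/

section LinearCode

variable {n η k : ℕ}

/-- The time of the `i`-th channel use in the `b`-th block. -/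
def blockTime (hk : k * η ≤ n) (p : Fin k × Fin η) : Fin n :=
  ⟨p.1 * η + p.2, by
    have h1 : (p.1 : ℕ) + 1 ≤ k := p.1.2
    have h2 := p.2.2
    nlinarith⟩

theorem blockTime_injective (hk : k * η ≤ n) : Function.Injective (blockTime hk) := by
  rintro ⟨b, i⟩ ⟨b', i'⟩ h
  have h : (b : ℕ) * η + i = b' * η + i' := congrArg Fin.val h
  have hη : 0 < η := i.pos
  have h1 := congrArg (· / η) h
  have h2 := congrArg (· % η) h
  simp only [Nat.mul_add_mod', Nat.mod_eq_of_lt i.2, Nat.mod_eq_of_lt i'.2] at h2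
  simp only [mul_comm _ η, Nat.mul_add_div hη, Nat.div_eq_of_lt i.2, Nat.div_eq_of_lt i'.2,
    add_zero] at h1
  exact Prod.ext (Fin.ext h1) (Fin.ext h2)

theorem mem_range_blockTime (hη : 0 < η) (hk : k * η ≤ n) {t : Fin n} (ht : (t : ℕ) / η < k) :
    t ∈ Set.range (blockTime hk) :=
  ⟨(⟨t / η, ht⟩, ⟨t % η, Nat.mod_lt _ hη⟩), Fin.ext (Nat.div_add_mod' t η)⟩

/-- The feedback code that in each of `k` blocks of length `η` uses the linear feedback scheme with
parameters `a ν` and `B ν`, the code symbols of the blocks being given by `x`. -/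
abbrev linearCode (n : ℕ) (hη : 0 < η) (M : Fin 2 → ℕ) (hM : ∀ ν, 0 < M ν) (a : Fin 2 → Fin η → ℝ)
    (B : Fin 2 → Matrix (Fin η) (Fin η) ℝ) (x : (ν : Fin 2) → Fin (M ν) → Fin k → ℝ)
    (dec : (Fin n → ℝ) → (ν : Fin 2) → Fin (M ν)) (hdec : Measurable dec) : FeedbackCode n where
  M := M
  M_pos := hM
  enc ν t m v :=
    if h : (t : ℕ) / η < k then
      a ν ⟨t % η, Nat.mod_lt _ hη⟩ * x ν m ⟨t / η, h⟩ +
        ∑ j : Fin η, if hj : (t : ℕ) / η * η + j < t then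
          B ν ⟨t % η, Nat.mod_lt _ hη⟩ j * v ⟨t / η * η + j, hj⟩ else 0
    else 0
  measurable_enc ν t m := by
    by_cases h : (t : ℕ) / η < k
    · simp only [h, dif_pos]
      refine measurable_const.add (Finset.measurable_sum _ fun j _ => ?_)
      by_cases hj : (t : ℕ) / η * η + j < t
      · simp only [hj, dif_pos]
        fun_prop
      · simp only [hj, dif_neg, not_false_eq_true]
        fun_prop
    · simp only [h, dif_neg, not_false_eq_true]
      fun_prop
  dec := dec
  measurable_dec := hdec

variable (hη : 0 < η) {M : Fin 2 → ℕ} (hM : ∀ ν, 0 < M ν) {a₁ a₂ : Fin η → ℝ}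
  {B₁ B₂ : Matrix (Fin η) (Fin η) ℝ} (x : (ν : Fin 2) → Fin (M ν) → Fin k → ℝ)
  {dec : (Fin n → ℝ) → (ν : Fin 2) → Fin (M ν)} (hdec : Measurable dec)

theorem input_linearCode_blockTime {a : Fin 2 → Fin η → ℝ} {B : Fin 2 → Matrix (Fin η) (Fin η) ℝ}
    (hB : ∀ ν, StrictlyLower (B ν)) (hk : k * η ≤ n)
    (ω : (linearCode n hη M hM a B x dec hdec).Sample) (ν : Fin 2) (b : Fin k) (i : Fin η) :
    (linearCode n hη M hM a B x dec hdec).input ω ν (blockTime hk (b, i)) =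
      a ν i * x ν (ω.1 ν) b + ∑ j, B ν i j *
        (linearCode n hη M hM a B x dec hdec).feedback ω ν (blockTime hk (b, j)) := by
  have h1 : ((b : ℕ) * η + i) / η = b := by
    rw [mul_comm, Nat.mul_add_div hη, Nat.div_eq_of_lt i.2, add_zero]
  have h2 : ((b : ℕ) * η + i) % η = i := by
    rw [Nat.mul_add_mod', Nat.mod_eq_of_lt i.2]
  have h3 : (linearCode n hη M hM a B x dec hdec).input ω ν (blockTime hk (b, i)) =
      if h : ((b : ℕ) * η + i) / η < k then
      a ν ⟨((b : ℕ) * η + i) % η, Nat.mod_lt _ hη⟩ * x ν (ω.1 ν) ⟨((b : ℕ) * η + i) / η, h⟩ +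
        ∑ j : Fin η, if hj : ((b : ℕ) * η + i) / η * η + j < (b : ℕ) * η + i then
          B ν ⟨((b : ℕ) * η + i) % η, Nat.mod_lt _ hη⟩ j *
            (linearCode n hη M hM a B x dec hdec).feedback ω ν
              ⟨((b : ℕ) * η + i) / η * η + j, hj.trans (blockTime hk (b, i)).2⟩ else 0
      else 0 := rfl
  rw [h3]
  simp only [h1, h2, b.2, dif_pos, Fin.eta]
  congr 1
  refine Finset.sum_congr rfl fun j _ => ?_
  by_cases hj : j < i
  · rw [dif_pos (by simpa using hj)]
    rfl
  -- Strict triangularity kills exactly the terms that the encoder drops for causality.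
  · rw [dif_neg (by simpa using hj), hB ν i j (not_lt.1 hj), zero_mul]

theorem input_linearCode_eq_zero {a : Fin 2 → Fin η → ℝ} {B : Fin 2 → Matrix (Fin η) (Fin η) ℝ}
    (ω : (linearCode n hη M hM a B x dec hdec).Sample) (ν : Fin 2) {t : Fin n}
    (ht : ¬ (t : ℕ) / η < k) : (linearCode n hη M hM a B x dec hdec).input ω ν t = 0 :=
  dif_neg ht

/-- Removal of the fed-back outputs from the output of a block. -/
def stripFeedback (hk : k * η ≤ n) (B₁ B₂ : Matrix (Fin η) (Fin η) ℝ) (y : Fin n → ℝ) (b : Fin k) :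
    Fin η → ℝ :=
  fun i => y (blockTime hk (b, i)) - ∑ j, (B₁ i j + B₂ i j) * y (blockTime hk (b, j))

theorem measurable_stripFeedback (hk : k * η ≤ n) (B₁ B₂ : Matrix (Fin η) (Fin η) ℝ) :
    Measurable (stripFeedback hk B₁ B₂) := by
  unfold stripFeedback; fun_prop

/-- Each feedback is `Y + W_ν`, so transmitter `ν` contributes `B_ν Y + B_ν W_ν`; the receiver
cancels the first term and the second joins `Z` in the residual noise. -/
theorem stripFeedback_output (hB₁ : StrictlyLower B₁) (hB₂ : StrictlyLower B₂) (hk : k * η ≤ n)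
    (ω : (linearCode n hη M hM ![a₁, a₂] ![B₁, B₂] x dec hdec).Sample) (b : Fin k) :
    stripFeedback hk B₁ B₂ ((linearCode n hη M hM ![a₁, a₂] ![B₁, B₂] x dec hdec).output ω) b =
      x 0 (ω.1 0) b • a₁ + x 1 (ω.1 1) b • a₂ +
        residualNoise B₁ B₂ fun i => ω.2 (blockTime hk (b, i)) := by
  have hB : ∀ ν, StrictlyLower (![B₁, B₂] ν) := by
    intro ν
    fin_cases ν
    · exact hB₁
    · exact hB₂
  ext i
  have h0 := input_linearCode_blockTime hη hM x hdec (a := ![a₁, a₂]) hB hk ω 0 b i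
  have h1 := input_linearCode_blockTime hη hM x hdec (a := ![a₁, a₂]) hB hk ω 1 b i
  simp only [FeedbackCode.feedback, mul_add, Finset.sum_add_distrib] at h0 h1
  simp only [stripFeedback, FeedbackCode.output_eq _ _ (blockTime hk (b, i)), h0, h1, Pi.add_apply,
    Pi.smul_apply, smul_eq_mul, residualNoise, Matrix.mulVec, dotProduct, Bb, Matrix.of_apply,
    Fintype.sum_prod_type, Fin.sum_univ_two, add_mul, Finset.sum_add_distrib,
    Matrix.cons_val_zero, Matrix.cons_val_one]
  ring

theorem input_linearCode (hB₁ : StrictlyLower B₁) (hB₂ : StrictlyLower B₂) (hk : k * η ≤ n)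
    (ω : (linearCode n hη M hM ![a₁, a₂] ![B₁, B₂] x dec hdec).Sample) (ν : Fin 2) (b : Fin k)
    (i : Fin η) :
    (linearCode n hη M hM ![a₁, a₂] ![B₁, B₂] x dec hdec).input ω ν (blockTime hk (b, i)) =
      inputSignal a₁ a₂ B₁ B₂ ![x 0 (ω.1 0) b, x 1 (ω.1 1) b] (ν, i) +
        inputNoise B₁ B₂ (fun i => ω.2 (blockTime hk (b, i))) (ν, i) := by
  have hB : ∀ ν, StrictlyLower (![B₁, B₂] ν) := by
    intro ν
    fin_cases ν
    · exact hB₁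
    · exact hB₂
  set X : Fin 2 × Fin η → ℝ := fun p =>
    (linearCode n hη M hM ![a₁, a₂] ![B₁, B₂] x dec hdec).input ω p.1 (blockTime hk (b, p.2)) with hX
  set xb : Fin 2 → ℝ := ![x 0 (ω.1 0) b, x 1 (ω.1 1) b] with hxb
  set R := Ad a₁ a₂ *ᵥ xb + ((Bt B₁ B₂ *ᵥ fun j => (ω.2 (blockTime hk (b, j))).1) +
    Bd B₁ B₂ *ᵥ fun q => (ω.2 (blockTime hk (b, q.2))).2 q.1) with hR
  have hdet : IsUnit (1 - BB B₁ B₂).det :=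
    (Matrix.isUnit_iff_isUnit_det _).1 (isUnit_one_sub_BB hB₁ hB₂)
  have hxx (ν : Fin 2) : xb ν = x ν (ω.1 ν) b := by fin_cases ν <;> rfl
  -- Substituting the outputs into the feedback makes the inputs of a block solve a linear system in
  -- themselves.
  have h1 : (1 - BB B₁ B₂) *ᵥ X = R := by
    ext p
    obtain ⟨ν, i⟩ := p
    have h0 := input_linearCode_blockTime hη hM x hdec (a := ![a₁, a₂]) hB hk ω ν b i
    simp only [FeedbackCode.feedback, FeedbackCode.output_eq] at h0
    have hXe : X (ν, i) = _ := h0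
    rw [Matrix.sub_mulVec, Matrix.one_mulVec, Pi.sub_apply, hXe, hR]
    simp only [Pi.add_apply, Matrix.mulVec, dotProduct, BB, Ad, Bt, Bd, Matrix.of_apply,
      Fintype.sum_prod_type, ite_mul, zero_mul, Finset.sum_ite_eq, Finset.mem_univ, if_true, hxx,
      mul_add, Finset.sum_add_distrib, hX]
    have hcomm : ∑ μ, ∑ j, (if ν = μ then ![B₁, B₂] ν i j *
        (ω.2 (blockTime hk (b, j))).2 μ else 0) =
        ∑ j, ![B₁, B₂] ν i j * (ω.2 (blockTime hk (b, j))).2 ν := by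
      rw [Finset.sum_comm]
      exact Finset.sum_congr rfl fun j _ => by simp
    rw [hcomm, Fin.sum_univ_two]
    ring
  have h2 : X = (1 - BB B₁ B₂)⁻¹ *ᵥ R := by
    rw [← h1, Matrix.mulVec_mulVec, Matrix.nonsing_inv_mul _ hdet, Matrix.one_mulVec]
  change X (ν, i) = _
  rw [h2, hR, Matrix.mulVec_add, Matrix.mulVec_mulVec]
  rfl

end LinearCode

/-! ### Power and error probability of the linear code -/

section CodeAnalysis

theorem isProbabilityMeasure_uniformMessages {M : Fin 2 → ℕ} (hM : ∀ ν, 0 < M ν) :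
    IsProbabilityMeasure
      (Measure.pi fun ν => uniformOn (Set.univ : Set (Fin (M ν)))) := by
  have h (ν : Fin 2) : IsProbabilityMeasure (uniformOn (Set.univ : Set (Fin (M ν)))) := by
    have : Nonempty (Fin (M ν)) := ⟨⟨0, hM ν⟩⟩
    exact isProbabilityMeasure_uniformOn Set.finite_univ Set.univ_nonempty
  infer_instance

theorem integrable_signal_add_noise_sq {A Ω : Type*} [Finite A] [MeasurableSpace A]
    [DiscreteMeasurableSpace A] [MeasurableSpace Ω] {μ : Measure A} {μ' : Measure Ω}
    [IsProbabilityMeasure μ] [IsProbabilityMeasure μ'] (S : A → ℝ) {g : Ω → ℝ} (hg : MemLp g 2 μ') :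
    Integrable (fun ω : A × Ω => (S ω.1 + g ω.2) ^ 2) (μ.prod μ') := by
  have hS : MemLp S 2 μ := MemLp.of_discrete
  exact ((hS.comp_measurePreserving measurePreserving_fst).add
    (hg.comp_measurePreserving measurePreserving_snd)).integrable_sq

theorem integral_signal_add_noise_sq {A Ω : Type*} [Finite A] [MeasurableSpace A]
    [DiscreteMeasurableSpace A] [MeasurableSpace Ω] {μ : Measure A} {μ' : Measure Ω}
    [IsProbabilityMeasure μ] [IsProbabilityMeasure μ'] (S : A → ℝ) {g : Ω → ℝ} (hg : MemLp g 2 μ')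
    {v : ℝ} (h : ∀ d : ℝ, ∫ ω, (d + g ω) ^ 2 ∂μ' = d ^ 2 + v) :
    ∫ ω, (S ω.1 + g ω.2) ^ 2 ∂(μ.prod μ') = ∫ m, S m ^ 2 ∂μ + v := by
  rw [integral_prod _ (integrable_signal_add_noise_sq S hg)]
  simp only [h]
  rw [integral_add (Integrable.of_finite) (integrable_const _)]
  simp

variable {n η k : ℕ} (hη : 0 < η) {M : Fin 2 → ℕ} (hM : ∀ ν, 0 < M ν) {a₁ a₂ : Fin η → ℝ}
  {B₁ B₂ : Matrix (Fin η) (Fin η) ℝ} (x : (ν : Fin 2) → Fin (M ν) → Fin k → ℝ)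
  {N : ℝ} {KW : Matrix (Fin 2) (Fin 2) ℝ}

theorem measurePreserving_block (hk : k * η ≤ n) (b : Fin k) :
    MeasurePreserving (fun (z : Fin n → ℝ × EuclideanSpace ℝ (Fin 2)) i => z (blockTime hk (b, i)))
      (Measure.pi fun _ => noiseLaw N KW) (Measure.pi fun _ => noiseLaw N KW) :=
  (measurePreserving_eval (fun _ : Fin k => Measure.pi fun _ : Fin η => noiseLaw N KW) b).comp
    (measurePreserving_blocks (blockTime_injective hk))

/-- The signal depends only on the messages and the noise part is centred and independent of them,
so cross terms vanish and the energies add. -/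
theorem satisfiesPower_linearCode {dec : (Fin n → ℝ) → (ν : Fin 2) → Fin (M ν)}
    (hdec : Measurable dec) (hN : 0 ≤ N) (hKW : KW.PosSemidef) (hB₁ : StrictlyLower B₁)
    (hB₂ : StrictlyLower B₂) (hk : k * η ≤ n) (ν : Fin 2) {P : ℝ}
    (hP : 1 / (n : ℝ) * (∫ m, ∑ b, signalEnergy a₁ a₂ B₁ B₂ ν (x 0 (m 0) b, x 1 (m 1) b)
      ∂(Measure.pi fun ν => uniformOn (Set.univ : Set (Fin (M ν)))) +
        k * noisePower N KW B₁ B₂ ν) ≤ P) :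
    (linearCode n hη M hM ![a₁, a₂] ![B₁, B₂] x dec hdec).SatisfiesPower N KW ν P := by
  have := isProbabilityMeasure_uniformMessages hM
  obtain ⟨Q, hQ, hmom⟩ : ∃ Q, (diagBlock Q ν).trace = noisePower N KW B₁ B₂ ν ∧
      HasSecondMoments (Measure.pi fun _ : Fin η => noiseLaw N KW)
        (fun p z => inputNoise B₁ B₂ z p) Q :=
    ⟨_, rfl, hasSecondMoments_inputNoise hN hKW B₁ B₂⟩
  have hmem (b : Fin k) (p : Fin 2 × Fin η) : MemLp (fun z : Fin n → ℝ × EuclideanSpace ℝ (Fin 2) =>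
      inputNoise B₁ B₂ (fun i => z (blockTime hk (b, i))) p) 2
      (Measure.pi fun _ => noiseLaw N KW) :=
    (hmom.memLp p).comp_measurePreserving (measurePreserving_block hk b)
  have hint (b : Fin k) (i : Fin η) (d : ℝ) :
      ∫ z : Fin n → ℝ × EuclideanSpace ℝ (Fin 2),
        (d + inputNoise B₁ B₂ (fun i => z (blockTime hk (b, i))) (ν, i)) ^ 2
        ∂(Measure.pi fun _ => noiseLaw N KW) = d ^ 2 + Q (ν, i) (ν, i) := by
    have hmp := measurePreserving_block (N := N) (KW := KW) hk b
    refine Eq.trans ?_ (hmom.integral_affine_sq d (ν, i))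
    rw [← hmp.map_eq, integral_map hmp.measurable.aemeasurable]
    rw [hmp.map_eq]
    exact (hmom.integrable_affine_sq d (ν, i)).aestronglyMeasurable
  have hzero (t : Fin n) (ht : t ∉ Set.range (blockTime hk))
      (ω : (linearCode n hη M hM ![a₁, a₂] ![B₁, B₂] x dec hdec).Sample) :
      (linearCode n hη M hM ![a₁, a₂] ![B₁, B₂] x dec hdec).input ω ν t = 0 :=
    input_linearCode_eq_zero hη hM x hdec ω ν fun h => ht (mem_range_blockTime hη hk h)
  set S : Fin k → Fin η → ((ν : Fin 2) → Fin (M ν)) → ℝ := fun b i m =>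
    inputSignal a₁ a₂ B₁ B₂ ![x 0 (m 0) b, x 1 (m 1) b] (ν, i) with hS
  set g : Fin k → Fin η → (Fin n → ℝ × EuclideanSpace ℝ (Fin 2)) → ℝ := fun b i z =>
    inputNoise B₁ B₂ (fun i => z (blockTime hk (b, i))) (ν, i) with hg
  have hfun (b : Fin k) (i : Fin η) :
      (fun ω => (linearCode n hη M hM ![a₁, a₂] ![B₁, B₂] x dec hdec).input ω ν
        (blockTime hk (b, i)) ^ 2) = fun ω => (S b i ω.1 + g b i ω.2) ^ 2 :=
    funext fun ω => congrArg (· ^ 2) (input_linearCode hη hM x hdec hB₁ hB₂ hk ω ν b i)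
  have hterm (b : Fin k) (i : Fin η) := integral_signal_add_noise_sq
    (μ := Measure.pi fun ν => uniformOn (Set.univ : Set (Fin (M ν)))) (S b i) (hmem b (ν, i))
    (hint b i)
  refine ⟨fun t => ?_, le_trans (le_of_eq ?_) hP⟩
  · by_cases ht : t ∈ Set.range (blockTime hk)
    · obtain ⟨⟨b, i⟩, rfl⟩ := ht
      rw [hfun]
      exact integrable_signal_add_noise_sq
        (μ := Measure.pi fun ν => uniformOn (Set.univ : Set (Fin (M ν)))) (S b i) (hmem b (ν, i))
    · simp [hzero t ht]
  · congr 1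
    -- Inputs outside the blocks are zero, so the sum over time is a sum over blocks and positions.
    rw [← Fintype.sum_of_injective (blockTime hk) (blockTime_injective hk) (fun p => ∫ ω,
      (linearCode n hη M hM ![a₁, a₂] ![B₁, B₂] x dec hdec).input ω ν (blockTime hk p) ^ 2
        ∂((linearCode n hη M hM ![a₁, a₂] ![B₁, B₂] x dec hdec).law N KW)) _
      (fun t ht => by simp [hzero t ht]) fun _ => rfl, Fintype.sum_prod_type]
    have hterm' (b : Fin k) (i : Fin η) : ∫ ω,
        (linearCode n hη M hM ![a₁, a₂] ![B₁, B₂] x dec hdec).input ω ν (blockTime hk (b, i)) ^ 2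
        ∂((linearCode n hη M hM ![a₁, a₂] ![B₁, B₂] x dec hdec).law N KW) =
        ∫ m, S b i m ^ 2 ∂(Measure.pi fun ν => uniformOn (Set.univ : Set (Fin (M ν)))) +
          Q (ν, i) (ν, i) := by
      rw [hfun]
      exact hterm b i
    simp only [hterm', Finset.sum_add_distrib]
    congr 1
    · simp only [signalEnergy]
      rw [integral_finsetSum _ fun _ _ => Integrable.of_finite]
      refine Finset.sum_congr rfl fun b _ => ?_
      rw [integral_finsetSum _ fun _ _ => Integrable.of_finite]
    · rw [Finset.sum_const, Finset.card_univ, Fintype.card_fin, nsmul_eq_mul, ← hQ]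
      rfl

theorem errorProb_linearCode {dec : (Fin k → Fin η → ℝ) → (ν : Fin 2) → Fin (M ν)}
    (hdec : Measurable dec) (hB₁ : StrictlyLower B₁) (hB₂ : StrictlyLower B₂) (hk : k * η ≤ n) :
    (linearCode n hη M hM ![a₁, a₂] ![B₁, B₂] x (dec ∘ stripFeedback hk B₁ B₂)
      (hdec.comp (measurable_stripFeedback hk B₁ B₂))).errorProb N KW =
    (∫⁻ m, (Measure.pi fun _ : Fin n => noiseLaw N KW) {z | dec (fun b => x 0 (m 0) b • a₁ +
      x 1 (m 1) b • a₂ + residualNoise B₁ B₂ fun i => z (blockTime hk (b, i))) ≠ m}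
      ∂(Measure.pi fun ν => uniformOn (Set.univ : Set (Fin (M ν))))).toReal := by
  have := isProbabilityMeasure_uniformMessages hM
  have hset : MeasurableSet {ω : ((ν : Fin 2) → Fin (M ν)) ×
      (Fin n → ℝ × EuclideanSpace ℝ (Fin 2)) | dec (fun b => x 0 (ω.1 0) b • a₁ +
      x 1 (ω.1 1) b • a₂ + residualNoise B₁ B₂ fun i => ω.2 (blockTime hk (b, i))) ≠ ω.1} := by
    have hx (ν : Fin 2) (b : Fin k) : Measurable fun ω : ((ν : Fin 2) → Fin (M ν)) ×
        (Fin n → ℝ × EuclideanSpace ℝ (Fin 2)) => x ν (ω.1 ν) b :=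
      (Measurable.of_discrete (f := fun m : (ν : Fin 2) → Fin (M ν) => x ν (m ν) b)).comp
        measurable_fst
    have hr := measurable_residualNoise B₁ B₂
    refine (measurableSet_eq_fun (hdec.comp ?_) measurable_fst).compl
    exact measurable_pi_iff.2 fun b => (((hx 0 b).smul_const _).add ((hx 1 b).smul_const _)).add
      (hr.comp (by fun_prop))
  refine Eq.trans (congrArg (fun S => ENNReal.toReal (((Measure.pi fun ν =>
    uniformOn (Set.univ : Set (Fin (M ν)))).prod (Measure.pi fun _ : Fin n => noiseLaw N KW)) S)) ?_)
    (congrArg ENNReal.toReal (Measure.prod_apply hset))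
  ext ω
  have h := funext fun b => stripFeedback_output hη hM x
    (hdec.comp (measurable_stripFeedback hk B₁ B₂)) (a₁ := a₁) (a₂ := a₂) hB₁ hB₂ hk ω b
  change dec (stripFeedback hk B₁ B₂ _) ≠ ω.1 ↔ _
  rw [h]
  rfl

end CodeAnalysis

/-! ### Error exponents and code sizes -/

section Asymptotics

theorem exists_code_uniformMessages {X Y Ω : Type*} [MeasurableSpace X] [MeasurableSpace Y]
    [MeasurableSpace Ω] {p : Measure X} {ν : Measure Ω} [IsProbabilityMeasure p]
    [IsProbabilityMeasure ν] {h : X × X × Ω → Y} {M : Fin 2 → ℕ} (hM : ∀ ν, 0 < M ν)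
    (hh : Measurable h) {J₁ J₂ J₁₂ : X × X × Y → ℝ≥0∞} (hJ₁ : Measurable J₁) (hJ₂ : Measurable J₂)
    (hJ₁₂ : Measurable J₁₂) {ε₁ ε₂ ε₁₂ : ℝ≥0∞}
    (h₁ : ∀ x₂ y, ∫⁻ x, J₁ (x, x₂, y) ∂p ≤ ε₁) (h₂ : ∀ x₁ y, ∫⁻ x, J₂ (x₁, x, y) ∂p ≤ ε₂)
    (h₁₂ : ∀ y, ∫⁻ x₁, ∫⁻ x₂, J₁₂ (x₁, x₂, y) ∂p ∂p ≤ ε₁₂)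
    {cost : X × X → ℝ≥0∞} (hcost : Measurable cost) :
    ∃ (x : (ν : Fin 2) → Fin (M ν) → X) (dec : Y → (ν : Fin 2) → Fin (M ν)), Measurable dec ∧
      ∫⁻ m, (ν {ω | dec (h (x 0 (m 0), x 1 (m 1), ω)) ≠ m} + cost (x 0 (m 0), x 1 (m 1)))
        ∂(Measure.pi fun ν => uniformOn (Set.univ : Set (Fin (M ν)))) ≤
        (∫⁻ x₁, ∫⁻ x₂, ν {ω | ¬ (1 ≤ J₁ (x₁, x₂, h (x₁, x₂, ω)) ∧
          1 ≤ J₂ (x₁, x₂, h (x₁, x₂, ω)) ∧ 1 ≤ J₁₂ (x₁, x₂, h (x₁, x₂, ω)))} ∂p ∂p) +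
        (((M 0 - 1 : ℕ) : ℝ≥0∞) * ε₁ + (((M 1 - 1 : ℕ) : ℝ≥0∞) * ε₂ +
          ((M 0 - 1 : ℕ) : ℝ≥0∞) * (((M 1 - 1 : ℕ) : ℝ≥0∞) * ε₁₂))) +
        ∫⁻ x₁, ∫⁻ x₂, cost (x₁, x₂) ∂p ∂p := by
  have hprob := isProbabilityMeasure_uniformMessages hM
  set μM := Measure.pi fun ν => uniformOn (Set.univ : Set (Fin (M ν)))
  set e := piFinTwoEquiv fun ν => Fin (M ν)
  have : Nonempty (Fin (M 0)) := ⟨⟨0, hM 0⟩⟩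
  have : Nonempty (Fin (M 1)) := ⟨⟨0, hM 1⟩⟩
  have hw : ∑ q, μM {e.symm q} = 1 := by
    rw [Equiv.sum_comp e.symm fun m => μM {m}, sum_measure_singleton, Finset.coe_univ, measure_univ]
  obtain ⟨c₁, c₂, dec, hdec, hle⟩ := exists_code_of_likelihood (p₁ := p) (p₂ := p) (ν := ν) hh hJ₁
    hJ₂ hJ₁₂ h₁ h₂ h₁₂ hcost hw
  refine ⟨Fin.cons c₁ (Fin.cons c₂ finZeroElim), fun y => e.symm (dec y),
    (Measurable.of_discrete (f := e.symm)).comp hdec, ?_⟩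
  rw [Fintype.card_fin, Fintype.card_fin] at hle
  refine le_trans (le_of_eq ?_) hle
  rw [lintegral_fintype, ← Equiv.sum_comp e.symm]
  refine Finset.sum_congr rfl fun q _ => ?_
  rw [mul_comm]
  congr 2
  congr 1
  ext ω
  exact (e.symm.injective.ne_iff (x := dec (h (c₁ q.1, c₂ q.2, ω))) (y := q))

/-- Failing the test forces the empirical mean below `γ`, at distance at least `∫ F - γ` from its
limit; Markov's inequality and the `L¹` law of large numbers make this unlikely. -/
theorem tendsto_measure_pi_exp_lt_one {S : Type*} [MeasurableSpace S] (μ : Measure S)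
    [IsProbabilityMeasure μ] {F : S → ℝ} (hF : Measurable F) (hFi : Integrable F μ) {γ : ℝ}
    (hγ : γ < ∫ s, F s ∂μ) :
    Tendsto (fun k : ℕ => (Measure.pi fun _ : Fin k => μ)
      {x | ¬ 1 ≤ ENNReal.ofReal (Real.exp (∑ b, F (x b) - k * γ))}) atTop (𝓝 0) := by
  set δ := ENNReal.ofReal (∫ s, F s ∂μ - γ) with hδ
  have hδ0 : δ ≠ 0 := by simpa [hδ] using hγ
  have hlim : Tendsto (fun k : ℕ => (∫⁻ x, ‖(k : ℝ)⁻¹ * ∑ b, F (x b) - ∫ s, F s ∂μ‖ₑ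
      ∂(Measure.pi fun _ : Fin k => μ)) / δ) atTop (𝓝 0) := by
    have := ENNReal.Tendsto.div_const (tendsto_lintegral_pi_average μ hF hFi) (b := δ)
      (Or.inr hδ0)
    simpa using this
  refine tendsto_of_tendsto_of_tendsto_of_le_of_le' tendsto_const_nhds hlim
    (Eventually.of_forall fun _ => zero_le) ?_
  filter_upwards [eventually_gt_atTop 0] with k hk
  have hk' : (0 : ℝ) < k := by exact_mod_cast hk
  have hm : Measurable fun x : Fin k → S => ‖(k : ℝ)⁻¹ * ∑ b, F (x b) - ∫ s, F s ∂μ‖ₑ := by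
    fun_prop
  refine le_trans (measure_mono fun x hx => ?_)
    (meas_ge_le_lintegral_div hm.aemeasurable hδ0 ENNReal.ofReal_ne_top)
  have hx' : ∑ b, F (x b) < k * γ := by
    have := not_le.1 hx
    rw [ENNReal.ofReal_lt_one, Real.exp_lt_one_iff] at this
    linarith
  have h2 : (k : ℝ)⁻¹ * ∑ b, F (x b) < γ := by
    rwa [inv_mul_lt_iff₀ hk']
  change δ ≤ ‖_‖ₑ
  rw [Real.enorm_eq_ofReal_abs, hδ]
  refine ENNReal.ofReal_le_ofReal (le_trans ?_ (neg_le_abs _))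
  linarith

theorem lintegral_pi_exp_sum_le {κ S : Type*} [Fintype κ] [MeasurableSpace S] (μ : Measure S)
    [IsProbabilityMeasure μ] {f : κ → S → ℝ} (hf : ∀ b, Measurable (f b))
    (h : ∀ b, ∫⁻ s, ENNReal.ofReal (Real.exp (f b s)) ∂μ ≤ 1) (c : ℝ) :
    ∫⁻ x, ENNReal.ofReal (Real.exp (∑ b, f b (x b) - c)) ∂(Measure.pi fun _ : κ => μ) ≤
      ENNReal.ofReal (Real.exp (-c)) := by
  have h1 (x : κ → S) : ENNReal.ofReal (Real.exp (∑ b, f b (x b) - c)) =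
      (∏ b, ENNReal.ofReal (Real.exp (f b (x b)))) * ENNReal.ofReal (Real.exp (-c)) := by
    rw [sub_eq_add_neg, Real.exp_add, ENNReal.ofReal_mul (Real.exp_nonneg _), Real.exp_sum,
      ENNReal.ofReal_prod_of_nonneg fun _ _ => Real.exp_nonneg _]
  simp_rw [h1]
  rw [lintegral_mul_const _ (by fun_prop),
    lintegral_pi_prod μ (f := fun b s => ENNReal.ofReal (Real.exp (f b s))) (by fun_prop)]
  exact mul_le_of_le_one_left zero_le (Finset.prod_le_one (fun _ _ => zero_le) fun b _ => h b)

theorem tendsto_exp_mul_sub_div_mul {η : ℕ} (hη : 0 < η) {r γ : ℝ} (h : η * r < γ) :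
    Tendsto (fun n : ℕ => ENNReal.ofReal (Real.exp (n * r - (n / η : ℕ) * γ))) atTop (𝓝 0) := by
  have hk : Tendsto (fun n : ℕ => ((n / η : ℕ) : ℝ)) atTop atTop :=
    tendsto_natCast_atTop_atTop.comp (Nat.tendsto_div_const_atTop hη.ne')
  -- The fewer than `η` leftover channel uses cost at most the constant `η * |r|` in the exponent.
  have h1 : Tendsto (fun n : ℕ => -(((n / η : ℕ) : ℝ) * (γ - η * r)) + η * |r|) atTop atBot :=
    tendsto_atBot_add_const_right _ _
      (tendsto_neg_atTop_atBot.comp (hk.atTop_mul_const (sub_pos.2 h)))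
  have h2 : Tendsto (fun n : ℕ => n * r - (n / η : ℕ) * γ) atTop atBot := by
    refine tendsto_atBot_mono (fun n => ?_) h1
    have h3 : ((n : ℕ) : ℝ) = (n / η : ℕ) * η + (n % η : ℕ) := by
      exact_mod_cast (Nat.div_add_mod' n η).symm
    have h4 : ((n % η : ℕ) : ℝ) * r ≤ η * |r| := by
      have h5 : ((n % η : ℕ) : ℝ) ≤ η := by exact_mod_cast (Nat.mod_lt n hη).le
      calc ((n % η : ℕ) : ℝ) * r ≤ (n % η : ℕ) * |r| := by gcongr; exact le_abs_self r
        _ ≤ η * |r| := by gcongr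
    have h6 : (n : ℝ) * r = (n / η : ℕ) * (η * r) + (n % η : ℕ) * r := by
      linear_combination r * h3
    linarith
  simpa using ENNReal.tendsto_ofReal (Real.tendsto_exp_atBot.comp h2)

/-- With `⌊exp (n r)⌋ + 1` messages the code is nonempty and has rate at least `r`, while the number
of wrong messages, which enters the union bound, is still at most `exp (n r)`. -/
theorem le_log_floor_exp {n : ℕ} (hn : 0 < n) (r : ℝ) :
    r ≤ 1 / (n : ℝ) * Real.log ((⌊Real.exp (n * r)⌋₊ + 1 : ℕ) : ℝ) := by
  have hn' : (0 : ℝ) < n := by exact_mod_cast hn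
  have h1 : Real.exp (n * r) ≤ ((⌊Real.exp (n * r)⌋₊ + 1 : ℕ) : ℝ) := by
    push_cast
    exact (Nat.lt_floor_add_one _).le
  have h2 := (Real.le_log_iff_exp_le (by positivity)).2 h1
  rw [one_div, le_inv_mul_iff₀ hn']
  exact h2

theorem natCast_floor_exp_le (a : ℝ) : ((⌊Real.exp a⌋₊ : ℕ) : ℝ≥0∞) ≤ ENNReal.ofReal (Real.exp a) := by
  rw [← ENNReal.ofReal_natCast]
  exact ENNReal.ofReal_le_ofReal (Nat.floor_le (Real.exp_nonneg _))

end Asymptotics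

/-! ### Random coding over blocks -/

section BlockCode

variable {n η k : ℕ} {a₁ a₂ : Fin η → ℝ} {B₁ B₂ : Matrix (Fin η) (Fin η) ℝ}
  {N : ℝ} {KW : Matrix (Fin 2) (Fin 2) ℝ}

/-- A function of the code symbols and the stripped outputs of a block, in terms of the noise. -/
noncomputable def atOutput (a₁ a₂ : Fin η → ℝ) (B₁ B₂ : Matrix (Fin η) (Fin η) ℝ)
    (i : ℝ × ℝ × (Fin η → ℝ) → ℝ) (q : ℝ × ℝ × (Fin η → ℝ × EuclideanSpace ℝ (Fin 2))) : ℝ :=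
  i (q.1, q.2.1, q.1 • a₁ + q.2.1 • a₂ + residualNoise B₁ B₂ q.2.2)

theorem measurable_atOutput {i : ℝ × ℝ × (Fin η → ℝ) → ℝ} (hi : Measurable i) :
    Measurable (atOutput a₁ a₂ B₁ B₂ i) := by
  have := measurable_residualNoise B₁ B₂
  unfold atOutput
  fun_prop

theorem exists_block_code {p : Measure ℝ} [IsProbabilityMeasure p] {M : Fin 2 → ℕ}
    (hM : ∀ ν, 0 < M ν) (hk : k * η ≤ n) {i₁ i₂ i₁₂ : ℝ × ℝ × (Fin η → ℝ) → ℝ} (hi₁ : Measurable i₁)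
    (hi₂ : Measurable i₂) (hi₁₂ : Measurable i₁₂)
    (h₁ : ∀ x₂ y, ∫⁻ x, ENNReal.ofReal (Real.exp (i₁ (x, x₂, y))) ∂p ≤ 1)
    (h₂ : ∀ x₁ y, ∫⁻ x, ENNReal.ofReal (Real.exp (i₂ (x₁, x, y))) ∂p ≤ 1)
    (h₁₂ : ∀ y, ∫⁻ x₁, ∫⁻ x₂, ENNReal.ofReal (Real.exp (i₁₂ (x₁, x₂, y))) ∂p ∂p ≤ 1)
    (γ₁ γ₂ γ₁₂ : ℝ) {cost : (Fin k → ℝ × ℝ) → ℝ≥0∞} (hcost : Measurable cost) :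
    ∃ (x : (ν : Fin 2) → Fin (M ν) → Fin k → ℝ)
      (dec : (Fin k → Fin η → ℝ) → (ν : Fin 2) → Fin (M ν)), Measurable dec ∧
      ∫⁻ m, ((Measure.pi fun _ : Fin n => noiseLaw N KW) {z | dec (fun b => x 0 (m 0) b • a₁ +
          x 1 (m 1) b • a₂ + residualNoise B₁ B₂ fun i => z (blockTime hk (b, i))) ≠ m} +
          cost fun b => (x 0 (m 0) b, x 1 (m 1) b))
        ∂(Measure.pi fun ν => uniformOn (Set.univ : Set (Fin (M ν)))) ≤
        ((Measure.pi fun _ : Fin k => p.prod (p.prod (Measure.pi fun _ => noiseLaw N KW)))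
          {q | ¬ 1 ≤ ENNReal.ofReal (Real.exp (∑ b, atOutput a₁ a₂ B₁ B₂ i₁ (q b) - k * γ₁))} +
        ((Measure.pi fun _ : Fin k => p.prod (p.prod (Measure.pi fun _ => noiseLaw N KW)))
          {q | ¬ 1 ≤ ENNReal.ofReal (Real.exp (∑ b, atOutput a₁ a₂ B₁ B₂ i₂ (q b) - k * γ₂))} +
        (Measure.pi fun _ : Fin k => p.prod (p.prod (Measure.pi fun _ => noiseLaw N KW)))
          {q | ¬ 1 ≤ ENNReal.ofReal (Real.exp (∑ b, atOutput a₁ a₂ B₁ B₂ i₁₂ (q b) - k * γ₁₂))})) +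
        (((M 0 - 1 : ℕ) : ℝ≥0∞) * ENNReal.ofReal (Real.exp (-(k * γ₁))) +
          (((M 1 - 1 : ℕ) : ℝ≥0∞) * ENNReal.ofReal (Real.exp (-(k * γ₂))) +
          ((M 0 - 1 : ℕ) : ℝ≥0∞) * (((M 1 - 1 : ℕ) : ℝ≥0∞) *
            ENNReal.ofReal (Real.exp (-(k * γ₁₂)))))) +
        ∫⁻ q, cost q ∂(Measure.pi fun _ : Fin k => p.prod p) := by
  have hres := measurable_residualNoise B₁ B₂
  set h : (Fin k → ℝ) × (Fin k → ℝ) × (Fin n → ℝ × EuclideanSpace ℝ (Fin 2)) →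
      Fin k → Fin η → ℝ := fun q b => q.1 b • a₁ + q.2.1 b • a₂ +
        residualNoise B₁ B₂ fun i => q.2.2 (blockTime hk (b, i)) with hdef
  have hh : Measurable h := by
    refine measurable_pi_iff.2 fun b => Measurable.add (by fun_prop) (hres.comp (by fun_prop))
  set J : (ℝ × ℝ × (Fin η → ℝ) → ℝ) → ℝ → (Fin k → ℝ) × (Fin k → ℝ) × (Fin k → Fin η → ℝ) → ℝ≥0∞ :=
    fun i γ q => ENNReal.ofReal (Real.exp (∑ b, i (q.1 b, q.2.1 b, q.2.2 b) - k * γ)) with hJ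
  have hJm (i : ℝ × ℝ × (Fin η → ℝ) → ℝ) (hi : Measurable i) (γ : ℝ) : Measurable (J i γ) := by
    simp only [hJ]; fun_prop
  obtain ⟨x, dec, hdec, hle⟩ := exists_code_uniformMessages
    (p := Measure.pi fun _ : Fin k => p) (ν := Measure.pi fun _ : Fin n => noiseLaw N KW)
    (ε₁₂ := ENNReal.ofReal (Real.exp (-(k * γ₁₂)))) hM hh
    (hJm i₁ hi₁ γ₁) (hJm i₂ hi₂ γ₂) (hJm i₁₂ hi₁₂ γ₁₂)
    (fun x₂ y => lintegral_pi_exp_sum_le p (f := fun b x => i₁ (x, x₂ b, y b))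
      (fun b => by fun_prop) (fun b => h₁ _ _) (k * γ₁))
    (fun x₁ y => lintegral_pi_exp_sum_le p (f := fun b x => i₂ (x₁ b, x, y b))
      (fun b => by fun_prop) (fun b => h₂ _ _) (k * γ₂))
    (fun y => by
      refine (lintegral_zip (p₁ := p) (p₂ := p) (φ := fun q => ENNReal.ofReal
        (Real.exp (∑ b, i₁₂ ((q b).1, (q b).2, y b) - k * γ₁₂))) (by fun_prop)).trans_le ?_
      refine lintegral_pi_exp_sum_le (p.prod p) (f := fun b q => i₁₂ (q.1, q.2, y b))
        (fun b => by fun_prop) (fun b => ?_) (k * γ₁₂)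
      rw [lintegral_prod _ (by fun_prop)]
      exact h₁₂ _)
    (cost := fun q => cost fun b => (q.1 b, q.2 b)) (by fun_prop)
  refine ⟨x, dec, hdec, hle.trans ?_⟩
  refine add_le_add (add_le_add ?_ le_rfl) (lintegral_zip hcost).le
  set bad : (ℝ × ℝ × (Fin η → ℝ) → ℝ) → ℝ →
      Set (Fin k → ℝ × ℝ × (Fin η → ℝ × EuclideanSpace ℝ (Fin 2))) := fun i γ =>
    {q | ¬ 1 ≤ ENNReal.ofReal (Real.exp (∑ b, atOutput a₁ a₂ B₁ B₂ i (q b) - k * γ))} with hbad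
  have hbm (i : ℝ × ℝ × (Fin η → ℝ) → ℝ) (hi : Measurable i) (γ : ℝ) :
      MeasurableSet (bad i γ) := by
    have := measurable_atOutput (a₁ := a₁) (a₂ := a₂) (B₁ := B₁) (B₂ := B₂) hi
    have hm : Measurable fun q : Fin k → ℝ × ℝ × (Fin η → ℝ × EuclideanSpace ℝ (Fin 2)) =>
      ENNReal.ofReal (Real.exp (∑ b, atOutput a₁ a₂ B₁ B₂ i (q b) - k * γ)) := by fun_prop
    exact (measurableSet_le measurable_const hm).compl
  have hUm := (hbm i₁ hi₁ γ₁).union ((hbm i₂ hi₂ γ₂).union (hbm i₁₂ hi₁₂ γ₁₂))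
  -- The event that the true pair fails some test, as an event on the independent blocks.
  set U := bad i₁ γ₁ ∪ (bad i₂ γ₂ ∪ bad i₁₂ γ₁₂) with hU
  have hzip := lintegral_zip_blocks (p₁ := p) (p₂ := p) (ν := noiseLaw N KW)
    (blockTime_injective hk) (φ := U.indicator 1) (measurable_one.indicator hUm)
  rw [lintegral_indicator_one hUm] at hzip
  refine le_trans (le_of_eq ?_) (hzip.trans_le ((measure_union_le _ _).trans
    (add_le_add le_rfl (measure_union_le _ _))))
  refine lintegral_congr fun x₁ => lintegral_congr fun x₂ => ?_
  have hpre : Measurable fun (z : Fin n → ℝ × EuclideanSpace ℝ (Fin 2)) (b : Fin k) =>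
    (x₁ b, x₂ b, fun i => z (blockTime hk (b, i))) := by fun_prop
  refine Eq.trans ?_ (lintegral_indicator_one (hpre hUm)).symm
  congr 1
  ext z
  simp only [hU, hbad, hJ, hdef, Set.mem_ofPred_eq, Set.mem_preimage, Set.mem_union, atOutput]
  tauto

end BlockCode

/-! ### Codebooks with vanishing error and energy deviation -/

section VanishingCodes

variable {η : ℕ} {a₁ a₂ : Fin η → ℝ} {B₁ B₂ : Matrix (Fin η) (Fin η) ℝ}
  {N : ℝ} {KW : Matrix (Fin 2) (Fin 2) ℝ}

/-- The information that a block conveys through `C` when the signal has covariance `s • T`. -/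
noncomputable def blockInformation {m : Type*} [Fintype m] [DecidableEq m] (N : ℝ)
    (KW : Matrix (Fin 2) (Fin 2) ℝ) (B₁ B₂ : Matrix (Fin η) (Fin η) ℝ) (C : Matrix m (Fin η) ℝ)
    (s : ℝ) (T : Matrix (Fin η) (Fin η) ℝ) : ℝ :=
  1 / 2 * Real.log ((C * (s • T + noiseCov N KW B₁ B₂) * Cᵀ).det /
    (C * noiseCov N KW B₁ B₂ * Cᵀ).det)

/-- The deviation of the empirical signal energy of a transmitter from its mean for independent
code symbols of variance `s`. -/
noncomputable def energyDeviation {k : ℕ} (a₁ a₂ : Fin η → ℝ) (B₁ B₂ : Matrix (Fin η) (Fin η) ℝ)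
    (s : ℝ) (ν : Fin 2) (q : Fin k → ℝ × ℝ) : ℝ≥0∞ :=
  ‖(k : ℝ)⁻¹ * ∑ b, signalEnergy a₁ a₂ B₁ B₂ ν (q b) - s * signalPower a₁ a₂ B₁ B₂ ν‖ₑ

theorem measurable_energyDeviation {k : ℕ} (s : ℝ) (ν : Fin 2) :
    Measurable (energyDeviation (k := k) a₁ a₂ B₁ B₂ s ν) := by
  have := measurable_signalEnergy a₁ a₂ B₁ B₂ ν
  unfold energyDeviation
  fun_prop

theorem tendsto_lintegral_energyDeviation {s : ℝ} (hs : 0 ≤ s) (ν : Fin 2) :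
    Tendsto (fun k : ℕ => ∫⁻ q, energyDeviation a₁ a₂ B₁ B₂ s ν q ∂(Measure.pi fun _ : Fin k =>
      (gaussianReal 0 s.toNNReal).prod (gaussianReal 0 s.toNNReal))) atTop (𝓝 0) := by
  have h := tendsto_lintegral_pi_average
    ((gaussianReal 0 s.toNNReal).prod (gaussianReal 0 s.toNNReal))
    (measurable_signalEnergy a₁ a₂ B₁ B₂ ν) (integrable_signalEnergy hs a₁ a₂ B₁ B₂ ν)
  rwa [integral_signalEnergy hs] at h

theorem natCast_floor_exp_mul_le (a b : ℝ) :
    ((⌊Real.exp a⌋₊ : ℕ) : ℝ≥0∞) * ENNReal.ofReal (Real.exp b) ≤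
      ENNReal.ofReal (Real.exp (a + b)) := by
  rw [Real.exp_add, ENNReal.ofReal_mul (Real.exp_nonneg _)]
  exact mul_le_mul_left (natCast_floor_exp_le a) _

theorem exists_vanishing_codes {m : Type*} [Fintype m] [DecidableEq m] (hη : 0 < η) (hN : 0 < N)
    (hKW : KW.PosSemidef) {C : Matrix m (Fin η) ℝ} (hC : IsUnit (C * Cᵀ)) {s : ℝ} (hs : 0 < s)
    {r : Fin 2 → ℝ}
    (h₁ : η * r 0 < blockInformation N KW B₁ B₂ C s (Matrix.vecMulVec a₁ a₁))
    (h₂ : η * r 1 < blockInformation N KW B₁ B₂ C s (Matrix.vecMulVec a₂ a₂))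
    (h₁₂ : η * (r 0 + r 1) < blockInformation N KW B₁ B₂ C s
      (Matrix.vecMulVec a₁ a₁ + Matrix.vecMulVec a₂ a₂)) :
    ∃ ε : ℕ → ℝ≥0∞, Tendsto ε atTop (𝓝 0) ∧ ∀ n : ℕ,
      ∃ (x : (ν : Fin 2) → Fin (⌊Real.exp (n * r ν)⌋₊ + 1) → Fin (n / η) → ℝ)
        (dec : (Fin (n / η) → Fin η → ℝ) → (ν : Fin 2) → Fin (⌊Real.exp (n * r ν)⌋₊ + 1)),
      Measurable dec ∧ ∫⁻ m, ((Measure.pi fun _ : Fin n => noiseLaw N KW) {z | dec (fun b =>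
          x 0 (m 0) b • a₁ + x 1 (m 1) b • a₂ + residualNoise B₁ B₂ fun i =>
            z (blockTime (Nat.div_mul_le_self n η) (b, i))) ≠ m} +
          (energyDeviation a₁ a₂ B₁ B₂ s 0 (fun b => (x 0 (m 0) b, x 1 (m 1) b)) +
            energyDeviation a₁ a₂ B₁ B₂ s 1 (fun b => (x 0 (m 0) b, x 1 (m 1) b))))
        ∂(Measure.pi fun ν => uniformOn
          (Set.univ : Set (Fin (⌊Real.exp (n * r ν)⌋₊ + 1)))) ≤ ε n := by
  obtain ⟨i₁, i₂, i₁₂, ⟨hm₁, hm₂, hm₁₂⟩, ⟨he₁, he₂, he₁₂⟩, hi⟩ := exists_infoDensities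
    (hasSecondMoments_residualNoise hN.le hKW B₁ B₂) hs a₁ a₂
    (posDef_mul_noiseCov_mul hN hKW B₁ B₂ hC)
  simp only [List.mem_cons, List.not_mem_nil, or_false, forall_eq_or_imp, forall_eq] at hi
  obtain ⟨⟨hint₁, hI₁⟩, ⟨hint₂, hI₂⟩, hint₁₂, hI₁₂⟩ := hi
  -- Each threshold lies strictly between the rate per block and the information per block: above
  -- the former, wrong codewords are rejected; below the latter, the true one is accepted.
  obtain ⟨γ₁, hγ₁, hγ₁'⟩ := exists_between h₁
  obtain ⟨γ₂, hγ₂, hγ₂'⟩ := exists_between h₂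
  obtain ⟨γ₁₂, hγ₁₂, hγ₁₂'⟩ := exists_between h₁₂
  have hdiv : Tendsto (fun n => n / η) atTop atTop := Nat.tendsto_div_const_atTop hη.ne'
  have hm {i : ℝ × ℝ × (Fin η → ℝ) → ℝ} (hi : Measurable i) :=
    measurable_atOutput (a₁ := a₁) (a₂ := a₂) (B₁ := B₁) (B₂ := B₂) hi
  have hbad₁ := (tendsto_measure_pi_exp_lt_one _ (hm hm₁) hint₁
    (hγ₁'.trans_eq hI₁.symm)).comp hdiv
  have hbad₂ := (tendsto_measure_pi_exp_lt_one _ (hm hm₂) hint₂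
    (hγ₂'.trans_eq hI₂.symm)).comp hdiv
  have hbad₁₂ := (tendsto_measure_pi_exp_lt_one _ (hm hm₁₂) hint₁₂
    (hγ₁₂'.trans_eq hI₁₂.symm)).comp hdiv
  have hdev₀ := (tendsto_lintegral_energyDeviation (a₁ := a₁) (a₂ := a₂) (B₁ := B₁) (B₂ := B₂)
    hs.le 0).comp hdiv
  have hdev₁ := (tendsto_lintegral_energyDeviation (a₁ := a₁) (a₂ := a₂) (B₁ := B₁) (B₂ := B₂)
    hs.le 1).comp hdiv
  have hlim := ((hbad₁.add (hbad₂.add hbad₁₂)).add ((tendsto_exp_mul_sub_div_mul hη hγ₁).add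
    ((tendsto_exp_mul_sub_div_mul hη hγ₂).add (tendsto_exp_mul_sub_div_mul hη hγ₁₂)))).add
    (hdev₀.add hdev₁)
  simp only [add_zero] at hlim
  refine ⟨_, hlim, fun n => ?_⟩
  have hmd (ν : Fin 2) := measurable_energyDeviation (k := n / η) (a₁ := a₁) (a₂ := a₂) (B₁ := B₁)
    (B₂ := B₂) s ν
  obtain ⟨x, dec, hdec, hle⟩ := exists_block_code (KW := KW) (N := N)
    (M := fun ν => ⌊Real.exp (n * r ν)⌋₊ + 1) (fun _ => Nat.succ_pos _) (Nat.div_mul_le_self n η)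
    hm₁ hm₂ hm₁₂ he₁ he₂ he₁₂ γ₁ γ₂ γ₁₂ ((hmd 0).add (hmd 1))
  refine ⟨x, dec, hdec, hle.trans (add_le_add (add_le_add le_rfl ?_) (lintegral_add_left (hmd 0) _).le)⟩
  simp only [Nat.add_sub_cancel]
  refine add_le_add (natCast_floor_exp_mul_le _ _) (add_le_add (natCast_floor_exp_mul_le _ _) ?_)
  -- Both codebook sizes multiply the joint error term, so the exponents `n * r 0` and `n * r 1`
  -- add.
  refine (mul_le_mul_right (natCast_floor_exp_mul_le _ _) _).trans
    ((natCast_floor_exp_mul_le _ _).trans_eq ?_)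
  congr 2
  ring

end VanishingCodes

/-! ### From codebooks to feedback codes that meet the power constraints -/

section Codes

variable {η : ℕ} {a₁ a₂ : Fin η → ℝ} {B₁ B₂ : Matrix (Fin η) (Fin η) ℝ}
  {N : ℝ} {KW : Matrix (Fin 2) (Fin 2) ℝ}

theorem integral_signalEnergy_le_of_energyDeviation_le {k : ℕ} {A : Type*} [Finite A]
    [MeasurableSpace A] [DiscreteMeasurableSpace A] {μ : Measure A} [IsProbabilityMeasure μ]
    (q : A → Fin k → ℝ × ℝ) {s : ℝ} {ν : Fin 2} {ε : ℝ≥0∞} (hε : ε ≠ ∞)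
    (h : ∫⁻ m, energyDeviation a₁ a₂ B₁ B₂ s ν (q m) ∂μ ≤ ε) :
    ∫ m, ∑ b, signalEnergy a₁ a₂ B₁ B₂ ν (q m b) ∂μ ≤
      k * (s * signalPower a₁ a₂ B₁ B₂ ν + ε.toReal) := by
  rcases Nat.eq_zero_or_pos k with rfl | hk
  · simp
  have hk' : (0 : ℝ) < k := by exact_mod_cast hk
  set D : A → ℝ := fun m =>
    (k : ℝ)⁻¹ * ∑ b, signalEnergy a₁ a₂ B₁ B₂ ν (q m b) - s * signalPower a₁ a₂ B₁ B₂ ν with hD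
  have hDle : ∫ m, ‖D m‖ ∂μ ≤ ε.toReal := by
    rw [integral_norm_eq_lintegral_enorm Measurable.of_discrete.aestronglyMeasurable]
    exact ENNReal.toReal_mono hε h
  calc ∫ m, ∑ b, signalEnergy a₁ a₂ B₁ B₂ ν (q m b) ∂μ
      ≤ ∫ m, k * (s * signalPower a₁ a₂ B₁ B₂ ν + ‖D m‖) ∂μ := by
        refine integral_mono Integrable.of_finite Integrable.of_finite fun m => ?_
        have h1 : ∑ b, signalEnergy a₁ a₂ B₁ B₂ ν (q m b) =
            k * (s * signalPower a₁ a₂ B₁ B₂ ν + D m) := by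
          simp only [hD]; field_simp; ring
        dsimp only
        rw [h1]
        gcongr
        exact Real.le_norm_self _
    _ = k * (s * signalPower a₁ a₂ B₁ B₂ ν + ∫ m, ‖D m‖ ∂μ) := by
        rw [integral_const_mul, integral_add Integrable.of_finite Integrable.of_finite]
        simp
    _ ≤ _ := by gcongr

/-- The deviation is covered by the slack `(1 - s) * signalPower`, so each block spends on average
at most the traced power `η * P`. The leftover times spend nothing, and `0 ≤ P` turns `k * η ≤ n`
into the average over all `n` uses. -/
theorem average_power_le {n k : ℕ} {A : Type*} [Finite A] [MeasurableSpace A]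
    [DiscreteMeasurableSpace A] {μ : Measure A} [IsProbabilityMeasure μ] (hn : 0 < n)
    (hk : k * η ≤ n) (q : A → Fin k → ℝ × ℝ) {s : ℝ} {ν : Fin 2} {ε : ℝ≥0∞} (hε : ε ≠ ∞)
    (h : ∫⁻ m, energyDeviation a₁ a₂ B₁ B₂ s ν (q m) ∂μ ≤ ε)
    (hsmall : signalPower a₁ a₂ B₁ B₂ ν ≠ 0 → ε.toReal ≤ (1 - s) * signalPower a₁ a₂ B₁ B₂ ν)
    {P : ℝ} (hP : 0 ≤ P)
    (htr : (diagBlock (inputCov N KW a₁ a₂ B₁ B₂) ν).trace ≤ η * P) :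
    1 / (n : ℝ) * (∫ m, ∑ b, signalEnergy a₁ a₂ B₁ B₂ ν (q m b) ∂μ +
      k * noisePower N KW B₁ B₂ ν) ≤ P := by
  rw [trace_diagBlock_inputCov] at htr
  have hn' : (0 : ℝ) < n := by exact_mod_cast hn
  have hk' : (k : ℝ) * η ≤ n := by exact_mod_cast hk
  have h1 : ∫ m, ∑ b, signalEnergy a₁ a₂ B₁ B₂ ν (q m b) ∂μ ≤
      k * signalPower a₁ a₂ B₁ B₂ ν := by
    by_cases h0 : signalPower a₁ a₂ B₁ B₂ ν = 0
    · simp [signalEnergy_eq_zero h0, h0]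
    · refine (integral_signalEnergy_le_of_energyDeviation_le q hε h).trans ?_
      gcongr
      linarith [hsmall h0]
  rw [one_div, inv_mul_le_iff₀ hn']
  calc _ ≤ (k : ℝ) * (signalPower a₁ a₂ B₁ B₂ ν + noisePower N KW B₁ B₂ ν) := by
        rw [mul_add]; gcongr
    _ ≤ k * (η * P) := by gcongr
    _ = k * η * P := by ring
    _ ≤ n * P := by gcongr

theorem exists_codes_of_lt_blockInformation {m : Type*} [Fintype m] [DecidableEq m] (hη : 0 < η)
    (hN : 0 < N) (hKW : KW.PosSemidef) (hB₁ : StrictlyLower B₁) (hB₂ : StrictlyLower B₂)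
    {P₁ P₂ : ℝ} (hP₁ : 0 ≤ P₁) (hP₂ : 0 ≤ P₂) (htr : TraceConstraints P₁ P₂ N KW a₁ a₂ B₁ B₂)
    {C : Matrix m (Fin η) ℝ} (hC : IsUnit (C * Cᵀ)) {s : ℝ} (hs : 0 < s) (hs1 : s < 1)
    {r : Fin 2 → ℝ}
    (h₁ : η * r 0 < blockInformation N KW B₁ B₂ C s (Matrix.vecMulVec a₁ a₁))
    (h₂ : η * r 1 < blockInformation N KW B₁ B₂ C s (Matrix.vecMulVec a₂ a₂))
    (h₁₂ : η * (r 0 + r 1) < blockInformation N KW B₁ B₂ C s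
      (Matrix.vecMulVec a₁ a₁ + Matrix.vecMulVec a₂ a₂)) :
    ∃ c : (n : ℕ) → FeedbackCode n,
      (∀ᶠ n in atTop, (c n).SatisfiesPower N KW 0 P₁ ∧ (c n).SatisfiesPower N KW 1 P₂ ∧
        r 0 ≤ (c n).rate 0 ∧ r 1 ≤ (c n).rate 1) ∧
      Tendsto (fun n => (c n).errorProb N KW) atTop (𝓝 0) := by
  obtain ⟨ε, hε, hcode⟩ := exists_vanishing_codes hη hN hKW hC hs h₁ h₂ h₁₂
  choose x dec hdec hle using hcode
  have hM (n : ℕ) (ν : Fin 2) : 0 < ⌊Real.exp (n * r ν)⌋₊ + 1 := Nat.succ_pos _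
  have hk (n : ℕ) : n / η * η ≤ n := Nat.div_mul_le_self n η
  have hfin : ∀ᶠ n in atTop, ε n ≠ ∞ :=
    (hε.eventually_lt_const ENNReal.zero_lt_top).mono fun n hn => hn.ne
  have hεr : Tendsto (fun n => (ε n).toReal) atTop (𝓝 0) := by
    exact (ENNReal.tendsto_toReal ENNReal.zero_ne_top).comp hε
  have hsmall (ν : Fin 2) : ∀ᶠ n in atTop, signalPower a₁ a₂ B₁ B₂ ν ≠ 0 →
      (ε n).toReal ≤ (1 - s) * signalPower a₁ a₂ B₁ B₂ ν := by
    by_cases h0 : signalPower a₁ a₂ B₁ B₂ ν = 0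
    · simp [h0]
    · have hpos := (signalPower_nonneg a₁ a₂ B₁ B₂ ν).lt_of_ne' h0
      exact (hεr.eventually_le_const (mul_pos (sub_pos.2 hs1) hpos)).mono fun n hn _ => hn
  refine ⟨fun n => linearCode n hη _ (hM n) ![a₁, a₂] ![B₁, B₂] (x n)
    (dec n ∘ stripFeedback (hk n) B₁ B₂)
    ((hdec n).comp (measurable_stripFeedback (hk n) B₁ B₂)), ?_, ?_⟩
  · filter_upwards [hfin, hsmall 0, hsmall 1, eventually_gt_atTop 0] with n hn h0 h1 hn0
    have := isProbabilityMeasure_uniformMessages (hM n)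
    have hp (ν : Fin 2) {P : ℝ} (hP : 0 ≤ P)
        (htr : (diagBlock (inputCov N KW a₁ a₂ B₁ B₂) ν).trace ≤ η * P)
        (hdev : ∀ q : Fin (n / η) → ℝ × ℝ, energyDeviation a₁ a₂ B₁ B₂ s ν q ≤
          energyDeviation a₁ a₂ B₁ B₂ s 0 q + energyDeviation a₁ a₂ B₁ B₂ s 1 q)
        (h : signalPower a₁ a₂ B₁ B₂ ν ≠ 0 →
          (ε n).toReal ≤ (1 - s) * signalPower a₁ a₂ B₁ B₂ ν) :=
      average_power_le (μ := Measure.pi fun ν => uniformOn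
        (Set.univ : Set (Fin (⌊Real.exp (n * r ν)⌋₊ + 1)))) hn0 (hk n)
        (fun m b => (x n 0 (m 0) b, x n 1 (m 1) b)) hn
        ((lintegral_mono fun m => (hdev _).trans le_add_self).trans (hle n)) h hP htr
    exact ⟨satisfiesPower_linearCode hη (hM n) (x n) _ hN.le hKW hB₁ hB₂ (hk n) 0
        (hp 0 hP₁ htr.1 (fun _ => le_self_add) h0),
      satisfiesPower_linearCode hη (hM n) (x n) _ hN.le hKW hB₁ hB₂ (hk n) 1
        (hp 1 hP₂ htr.2 (fun _ => le_add_self) h1),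
      le_log_floor_exp hn0 _, le_log_floor_exp hn0 _⟩
  · refine squeeze_zero' (Eventually.of_forall fun n => measureReal_nonneg) ?_ hεr
    filter_upwards [hfin] with n hn
    rw [errorProb_linearCode hη (hM n) (x n) (hdec n) hB₁ hB₂ (hk n)]
    exact ENNReal.toReal_mono hn ((lintegral_mono fun m => le_self_add).trans (hle n))

end Codes

/-! ### The limit `s → 1`, degenerate cases and closure -/

section Achievability

variable {η : ℕ} {a₁ a₂ : Fin η → ℝ} {B₁ B₂ : Matrix (Fin η) (Fin η) ℝ}
  {N : ℝ} {KW : Matrix (Fin 2) (Fin 2) ℝ}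

theorem blockInformation_one {m : Type} [Fintype m] [DecidableEq m] (hη : 0 < η)
    (C : Matrix m (Fin η) ℝ) (T : Matrix (Fin η) (Fin η) ℝ) :
    blockInformation N KW B₁ B₂ C 1 T = η * rateBound N KW B₁ B₂ C T := by
  have : (η : ℝ) ≠ 0 := by exact_mod_cast hη.ne'
  rw [blockInformation, rateBound, one_smul]
  field_simp

theorem continuousAt_blockInformation {m : Type*} [Fintype m] [DecidableEq m] (hN : 0 < N)
    (hKW : KW.PosSemidef) {C : Matrix m (Fin η) ℝ} (hC : IsUnit (C * Cᵀ))
    {T : Matrix (Fin η) (Fin η) ℝ} (hT : T.PosSemidef) :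
    ContinuousAt (fun s => blockInformation N KW B₁ B₂ C s T) 1 := by
  have hS := posDef_mul_noiseCov_mul hN hKW B₁ B₂ hC
  have hS' : (C * ((1 : ℝ) • T + noiseCov N KW B₁ B₂) * Cᵀ).PosDef := by
    rw [one_smul, Matrix.mul_add, Matrix.add_mul, add_comm]
    refine hS.add_posSemidef ?_
    simpa using hT.mul_mul_conjTranspose_same C
  unfold blockInformation
  have hc : ContinuousAt (fun s : ℝ => (C * (s • T + noiseCov N KW B₁ B₂) * Cᵀ).det /
      (C * noiseCov N KW B₁ B₂ * Cᵀ).det) 1 := by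
    refine Continuous.continuousAt ?_
    fun_prop
  exact continuousAt_const.mul (hc.log (div_pos hS'.det_pos hS.det_pos).ne')

theorem Ab_mul_transpose (a₁ a₂ : Fin η → ℝ) :
    Ab a₁ a₂ * (Ab a₁ a₂)ᵀ = Matrix.vecMulVec a₁ a₁ + Matrix.vecMulVec a₂ a₂ := by
  ext i j
  simp [Ab, Matrix.mul_apply, Fin.sum_univ_two, Matrix.vecMulVec_apply]

theorem achievable_of_mem_logDetRegion {m : Type} [Fintype m] [DecidableEq m] (hη : 0 < η)
    (hN : 0 < N) (hKW : KW.PosSemidef) (hB₁ : StrictlyLower B₁) (hB₂ : StrictlyLower B₂)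
    {P₁ P₂ : ℝ} (hP₁ : 0 ≤ P₁) (hP₂ : 0 ≤ P₂) (htr : TraceConstraints P₁ P₂ N KW a₁ a₂ B₁ B₂)
    {C : Matrix m (Fin η) ℝ} (hC : IsUnit (C * Cᵀ)) {R : ℝ × ℝ}
    (hR : R ∈ logDetRegion N KW a₁ a₂ B₁ B₂ C) : Achievable P₁ P₂ N KW R := by
  intro δ hδ
  obtain ⟨-, -, hR₁, hR₂, hR₁₂⟩ := hR
  have hη' : (0 : ℝ) < η := by exact_mod_cast hη
  have hpsd (a : Fin η → ℝ) : (Matrix.vecMulVec a a).PosSemidef := by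
    simpa using Matrix.posSemidef_vecMulVec_self_star a
  have hev {ρ : ℝ} {T : Matrix (Fin η) (Fin η) ℝ} (hT : T.PosSemidef)
      (h : ρ < rateBound N KW B₁ B₂ C T) :
      -- The limit is taken from the left because the power argument needs `s < 1`.
      ∀ᶠ s in 𝓝[<] (1 : ℝ), η * ρ < blockInformation N KW B₁ B₂ C s T := by
    refine ((continuousAt_blockInformation hN hKW hC hT).eventually_const_lt ?_).filter_mono
      nhdsWithin_le_nhds
    beta_reduce
    rw [blockInformation_one hη]
    gcongr
  rw [Ab_mul_transpose] at hR₁₂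
  have h₁ := hev (ρ := R.1 - δ / 2) (hpsd a₁) (by linarith)
  have h₂ := hev (ρ := R.2 - δ / 2) (hpsd a₂) (by linarith)
  have h₁₂ := hev (ρ := R.1 - δ / 2 + (R.2 - δ / 2)) ((hpsd a₁).add (hpsd a₂)) (by linarith)
  have hs : ∀ᶠ s in 𝓝[<] (1 : ℝ), 0 < s :=
    (eventually_gt_nhds zero_lt_one).filter_mono nhdsWithin_le_nhds
  obtain ⟨s, hs₁, hs₂, hs₁₂, hs0, hs1⟩ :=
    (h₁.and (h₂.and (h₁₂.and (hs.and self_mem_nhdsWithin)))).exists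
  -- Giving up `δ / 2` makes the three rate bounds strict, as `s < 1` requires, and still leaves
  -- rates above `R - δ`.
  obtain ⟨c, hc, herr⟩ := exists_codes_of_lt_blockInformation (r := ![R.1 - δ / 2, R.2 - δ / 2])
    hη hN hKW hB₁ hB₂ hP₁ hP₂ htr hC hs0 hs1 hs₁ hs₂ hs₁₂
  refine ⟨c, hc.mono fun n ⟨hp₁, hp₂, hr₁, hr₂⟩ => ⟨hp₁, hp₂, ?_, ?_⟩, herr⟩
  · exact lt_of_lt_of_le (by linarith) (show R.1 - δ / 2 ≤ _ from hr₁)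
  · exact lt_of_lt_of_le (by linarith) (show R.2 - δ / 2 ≤ _ from hr₂)

/-- One message per user and zero inputs: no power is spent and no error is possible. -/
theorem achievable_zero {P₁ P₂ : ℝ} (hP₁ : 0 ≤ P₁) (hP₂ : 0 ≤ P₂) :
    Achievable P₁ P₂ N KW (0, 0) := by
  intro δ hδ
  refine ⟨fun n => ⟨fun _ => 1, fun _ => one_pos, fun _ _ _ _ => 0, fun _ _ _ => measurable_const,
    fun _ _ => 0, measurable_const⟩, Eventually.of_forall fun n => ?_, ?_⟩
  · simp [FeedbackCode.SatisfiesPower, FeedbackCode.rate, FeedbackCode.input, hP₁, hP₂, hδ]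
  · refine tendsto_const_nhds.congr fun n => ?_
    refine Eq.symm ?_
    unfold FeedbackCode.errorProb
    convert measureReal_empty
    exact Set.eq_empty_of_forall_notMem fun ω h =>
      h (Subsingleton.elim (α := (ν : Fin 2) → Fin 1) _ _)

theorem isUnit_replicateRow_mul_transpose {v : Fin η → ℝ} (hv : v ≠ 0) :
    IsUnit (Matrix.replicateRow Unit v * (Matrix.replicateRow Unit v)ᵀ) := by
  rw [Matrix.isUnit_iff_isUnit_det, isUnit_iff_ne_zero]
  simpa [Matrix.det_unique, Matrix.mul_apply, dotProduct] using
    (dotProduct_self_eq_zero (v := v)).not.2 hv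

theorem achievable_of_mem_paramRegion (hη : 0 < η) (hN : 0 < N) (hKW : KW.PosSemidef)
    (hB₁ : StrictlyLower B₁) (hB₂ : StrictlyLower B₂) {P₁ P₂ : ℝ} (hP₁ : 0 ≤ P₁) (hP₂ : 0 ≤ P₂)
    (htr : TraceConstraints P₁ P₂ N KW a₁ a₂ B₁ B₂) {C : Matrix (Fin 2) (Fin η) ℝ} {R : ℝ × ℝ}
    (hR : R ∈ paramRegion N KW a₁ a₂ B₁ B₂ C) : R ∈ capacityNoisyFB P₁ P₂ N KW := by
  unfold paramRegion at hR
  split_ifs at hR with hC h0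
  · exact ⟨hR.1, hR.2.1,
      achievable_of_mem_logDetRegion hη hN hKW hB₁ hB₂ hP₁ hP₂ htr hC hR⟩
  · obtain ⟨i, hi, hR⟩ := hR
    exact ⟨hR.1, hR.2.1, achievable_of_mem_logDetRegion hη hN hKW hB₁ hB₂ hP₁ hP₂ htr
      (isUnit_replicateRow_mul_transpose hi) hR⟩
  · obtain rfl : R = (0, 0) := hR
    exact ⟨le_rfl, le_rfl, achievable_zero hP₁ hP₂⟩

/-- The slack `δ` is split in half, between the distance to a nearby achievable pair and the rate
loss of the codes for that pair. -/
theorem isClosed_capacityNoisyFB (P₁ P₂ N : ℝ) (KW : Matrix (Fin 2) (Fin 2) ℝ) :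
    IsClosed (capacityNoisyFB P₁ P₂ N KW) := by
  refine isClosed_of_closure_subset fun R hR => ⟨?_, ?_, fun δ hδ => ?_⟩
  · exact closure_minimal (fun R hR => hR.1) (isClosed_le continuous_const continuous_fst) hR
  · exact closure_minimal (fun R hR => hR.2.1) (isClosed_le continuous_const continuous_snd) hR
  · obtain ⟨R', hR', hd⟩ := Metric.mem_closure_iff.1 hR (δ / 2) (half_pos hδ)
    obtain ⟨c, hc, herr⟩ := hR'.2.2 (δ / 2) (half_pos hδ)
    rw [Prod.dist_eq, max_lt_iff, Real.dist_eq, Real.dist_eq] at hd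
    have h1 := (abs_lt.1 hd.1).2
    have h2 := (abs_lt.1 hd.2).2
    exact ⟨c, hc.mono fun n ⟨hp₁, hp₂, hr₁, hr₂⟩ => ⟨hp₁, hp₂, by linarith, by linarith⟩, herr⟩

end Achievability

end NoisyFBMAC

theorem mainTheorem1 (P₁ P₂ N : ℝ) (hP₁ : 0 ≤ P₁) (hP₂ : 0 ≤ P₂) (hN : 0 < N)
    (KW : Matrix (Fin 2) (Fin 2) ℝ) (hKW : KW.PosSemidef) :
    NoisyFBMAC.region P₁ P₂ N KW ⊆ NoisyFBMAC.capacityNoisyFB P₁ P₂ N KW := by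
  refine closure_minimal ?_ (NoisyFBMAC.isClosed_capacityNoisyFB P₁ P₂ N KW)
  rintro R ⟨η, a₁, a₂, B₁, B₂, C, hη, hB₁, hB₂, htr, hR⟩
  exact NoisyFBMAC.achievable_of_mem_paramRegion hη hN hKW hB₁ hB₂ hP₁ hP₂ htr hR
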